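/- Fix $H\in(\tfrac12,1)$, put $c_H=\sqrt{\frac{2H\,\Gamma(3/2-H)}{\Gamma(H+1/2)\,\Gamma(2-2H)}}$ and, for $s,t\in[0,1]$, $$z(t,s)=\mathbf 1_{\{t\ge s\}}\,c_H\,(H-\tfrac12)\,s^{1/2-H}\int_s^t u^{H-1/2}(u-s)^{H-3/2}\,du .$$ On a probability space let, for every $n\ge1$, $\xi^n_1,\dots,\xi^n_n$ be independent random variables with $P(\xi^n_i=1)=P(\xi^n_i=-1)=\tfrac12$, and define for $t\in[0,1]$ $$B^{H,n}_t=\sum_{i=1}^{\lfloor nt\rfloor} b^n_{t,i}\,\xi^n_i,\qquad b^n_{t,i}=\sqrt n\int_{(i-1)/n}^{i/n} z\Big(\frac{\lfloor nt\rfloor}{n},u\Big)\,du .$$ For $A\subseteq\{1,\dots,n\}$ let $\Xi^n_A=\prod_{i\in A}\xi^n_i$; every random variable $X$ that is a function of $\xi^n_1,\dots,\xi^n_n$ has a unique expansion $X=\sum_A x_A\Xi^n_A$ with real $x_A$. The discrete Wick product of $X=\sum_A x_A\Xi^n_A$ and $Y=\sum_B y_B\Xi^n_B$ is $$X\diamond_n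 Y=\sum_{C}\Big(\sum_{A\cup B=C,\;A\cap B=\emptyset}x_Ay_B\Big)\Xi^n_C,$$ and $X^{\diamond_n 0}=1$, $X^{\diamond_n(k+1)}=X^{\diamond_n k}\diamond_n X$. Let $B^H=(B^H_t)_{t\in[0,1]}$ be a fractional Brownian motion with Hurst parameter $H$ (possibly on another probability space), that is, a continuous centred Gaussian process with $\mathbf E[B^H_tB^H_s]=\tfrac12(t^{2H}+s^{2H}-|t-s|^{2H})$. For a centred Gaussian variable $\Phi$ put $\exp^\diamond(\Phi)=\exp(\Phi-\tfrac12\mathbf E[\Phi^2])$. The Wick product $\diamond$ is the extension to random variables in $L^2(\sigma(B^H))$ of $\exp^\diamond(\Phi)\diamond\exp^\diamond(\Psi)=\exp^\diamond(\Phi+\Psi)$, with $\Phi,\Psi$ in the linear span of $B^H$; that is, $Z=X\diamond Y$ is the a.s. unique element of $L^2(\sigma(B^H))$, if there is one, such that $\mathbf E[Z\exp^\diamond(\Psi)]=\mathbf E[X\exp^\diamond(\Psi)]\,\mathbf E[Y\exp^\diamond(\Psi)]$ for all $\Psi$ in the linear span of $B^H$. The Wick powers are $\Phi^{\diamond0}=1$,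 $\Phi^{\diamond1}=\Phi$, $\Phi^{\diamond(k+1)}=\Phi^{\diamond k}\diamond\Phi$. **Proposition.** (i) For all $0\le s\le t\le1$, all integers $n\ge1$ and $N\ge0$ with $\lfloor ns\rfloor\ge N$, $$0\le \mathbf E[(B^{H,n}_t)^2]^N+\mathbf E[(B^{H,n}_s)^2]^N-2\,\mathbf E[B^{H,n}_tB^{H,n}_s]^N-\frac1{N!}\mathbf E\Big[\big((B^{H,n}_t)^{\diamond_nN}-(B^{H,n}_s)^{\diamond_nN}\big)^2\Big]\le 2c_H^2N^2\,t^{2H(N-1)}\,n^{-(2-2H)}$$ (for $N=0$ the upper bound is read as $0$). (ii) For all $0\le s\le t\le1$ and all integers $N\ge0$, $$\lim_{n\to\infty}\mathbf E\Big[\big((B^{H,n}_t)^{\diamond_nN}-(B^{H,n}_s)^{\diamond_nN}\big)^2\Big]=\mathbf E\Big[\big((B^{H}_t)^{\diamond N}-(B^{H}_s)^{\diamond N}\big)^2\Big].$$ -/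

import Mathlib

open MeasureTheory ProbabilityTheory Filter Topology

noncomputable section

namespace WickFBM

/-! ### The kernel of fractional Brownian motion -/

/-- The constant `c_H = √(2HΓ(3/2 - H) / (Γ(H + 1/2)Γ(2 - 2H)))`. -/
def cH (H : ℝ) : ℝ :=
  Real.sqrt (2 * H * Real.Gamma (3 / 2 - H) / (Real.Gamma (H + 1 / 2) * Real.Gamma (2 - 2 * H)))

/-- The Molchan-Golosov kernel
`z_H(t,s) = 1_{t ≥ s} c_H (H - 1/2) s^{1/2 - H} ∫_s^t u^{H - 1/2} (u - s)^{H - 3/2} du`,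
for `1/2 < H < 1` and `s, t ∈ [0,1]`. -/
def kernel (H t s : ℝ) : ℝ :=
  if s ≤ t then
    cH H * (H - 1 / 2) * s ^ (1 / 2 - H) *
      ∫ u in s..t, u ^ (H - 1 / 2) * (u - s) ^ (H - 3 / 2)
  else 0

/-! ### Symmetric Bernoulli variables and the discrete Wick product

The usual indices `1, …, n` are represented by `Fin n`: the element `i : Fin n` stands for the
index `i + 1`. -/

/-- For every `n`, the `n` real random variables `ξ n i` are independent and take the
values `1` and `-1` with probability `1/2` each. Nothing is assumed on the joint law of the rows
for different `n`. -/
structure IsBernoulliArray {Ω : Type*} [MeasurableSpace Ω] (P : Measure Ω)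
    (ξ : (n : ℕ) → Fin n → Ω → ℝ) : Prop where
  measurable : ∀ n i, Measurable (ξ n i)
  prob_one : ∀ n i, P {ω | ξ n i ω = 1} = 1 / 2
  prob_neg_one : ∀ n i, P {ω | ξ n i ω = -1} = 1 / 2
  indep : ∀ n, iIndepFun (ξ n) P

section Discrete

variable {Ω : Type*} [MeasurableSpace Ω]

/-- The Walsh function `Ξ_A = ∏_{i ∈ A} ξ_i`. -/
def walsh {n : ℕ} (ξ : Fin n → Ω → ℝ) (A : Finset (Fin n)) (ω : Ω) : ℝ :=
  ∏ i ∈ A, ξ i ω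

/-- The coefficient `x_A` of `X` in its Walsh decomposition `X = ∑_A x_A Ξ_A`; since the `Ξ_A` form
an orthonormal basis of `L²(σ(ξ_1, …, ξ_n))`, it is the inner product `E[X Ξ_A]`. -/
def walshCoeff {n : ℕ} (P : Measure Ω) (ξ : Fin n → Ω → ℝ) (X : Ω → ℝ) (A : Finset (Fin n)) : ℝ :=
  ∫ ω, X ω * walsh ξ A ω ∂P

/-- The discrete Wick product
`X ⋄ₙ Y = ∑_C (∑_{A ∪ B = C, A ∩ B = ∅} x_A y_B) Ξ_C` of `X, Y ∈ L²(σ(ξ_1, …, ξ_n))`. -/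
def discreteWick {n : ℕ} (P : Measure Ω) (ξ : Fin n → Ω → ℝ) (X Y : Ω → ℝ) (ω : Ω) : ℝ :=
  ∑ C : Finset (Fin n),
    (∑ p : Finset (Fin n) × Finset (Fin n) with p.1 ∪ p.2 = C ∧ p.1 ∩ p.2 = ∅,
      walshCoeff P ξ X p.1 * walshCoeff P ξ Y p.2) * walsh ξ C ω

/-- The discrete Wick powers: `X^{⋄ₙ 0} = 1` and `X^{⋄ₙ (k+1)} = X^{⋄ₙ k} ⋄ₙ X`. -/
def discreteWickPow {n : ℕ} (P : Measure Ω) (ξ : Fin n → Ω → ℝ) (X : Ω → ℝ) : ℕ → Ω → ℝ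
  | 0 => fun _ => 1
  | k + 1 => discreteWick P ξ (discreteWickPow P ξ X k) X

/-- The coefficient `b_{t,i}^n = √n ∫_{(i-1)/n}^{i/n} z_H(⌊nt⌋/n, s) ds`
(with the index shift of `Fin n`). -/
def bCoeff (H : ℝ) (n : ℕ) (t : ℝ) (i : Fin n) : ℝ :=
  Real.sqrt n *
    ∫ s in ((i : ℕ) : ℝ) / n..(((i : ℕ) : ℝ) + 1) / n, kernel H ((⌊(n : ℝ) * t⌋₊ : ℝ) / n) s

/-- The disturbed binary random walk `B^{H,n}_t = ∑_{i=1}^{⌊nt⌋} b_{t,i}^n ξ_i`. -/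
def disturbedWalk (H : ℝ) {n : ℕ} (ξ : Fin n → Ω → ℝ) (t : ℝ) (ω : Ω) : ℝ :=
  ∑ i : Fin n with i.val + 1 ≤ ⌊(n : ℝ) * t⌋₊, bCoeff H n t i * ξ i ω

end Discrete

/-! ### Fractional Brownian motion and the continuous Wick product -/

/-- `B` is a fractional Brownian motion on `[0,1]` with Hurst parameter `H`: a centred Gaussian
process with almost surely continuous paths and covariance `(t^{2H} + s^{2H} - |t - s|^{2H}) / 2`
(stationarity of the increments is a consequence). -/
structure IsFBM {Ω : Type*} [MeasurableSpace Ω] (P : Measure Ω) (H : ℝ)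
    (B : unitInterval → Ω → ℝ) : Prop where
  measurable : ∀ t, Measurable (B t)
  gaussian : IsGaussianProcess B P
  mean_zero : ∀ t, ∫ ω, B t ω ∂P = 0
  covariance : ∀ s t, ∫ ω, B t ω * B s ω ∂P =
    ((t : ℝ) ^ (2 * H) + (s : ℝ) ^ (2 * H) - |(t : ℝ) - s| ^ (2 * H)) / 2
  continuous_paths : ∀ᵐ ω ∂P, Continuous fun t => B t ω

section Continuous

variable {Ω T : Type*} [MeasurableSpace Ω]

/-- The Wick exponential `exp^⋄(Φ) = exp(Φ - E[|Φ|²] / 2)` of a centred Gaussian variable. -/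
def wickExp (P : Measure Ω) (Φ : Ω → ℝ) (ω : Ω) : ℝ :=
  Real.exp (Φ ω - (∫ ω', |Φ ω'| ^ 2 ∂P) / 2)

/-- `X` is a square-integrable functional of the process `B`, that is, `X ∈ L²(Ω, σ(B), P)`. -/
def IsL2Functional (P : Measure Ω) (B : T → Ω → ℝ) (X : Ω → ℝ) : Prop :=
  AEStronglyMeasurable[⨆ t, MeasurableSpace.comap (B t) inferInstance] X P ∧ MemLp X 2 P

/-- `Z` is the Wick product `X ⋄ Y`, where `X, Y, Z ∈ L²(Ω, σ(B), P)` for a centred Gaussian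
process `B`. The Wick product is the extension of
`exp^⋄(Φ) ⋄ exp^⋄(Ψ) = exp^⋄(Φ + Ψ)` from the Wick exponentials of the Gaussian variables `Φ, Ψ` in
the linear span of `B`, whose linear combinations are dense in `L²(Ω, σ(B), P)`.
It is expressed by testing with Wick exponentials (the S-transform
`(S X)(Ψ) = E[X exp^⋄(Ψ)]`, which is injective): `S (X ⋄ Y) = S X · S Y`. On Wick exponentials this
is the defining relation, because `(S exp^⋄(Φ))(Ψ) = exp(E[Φ Ψ])`. -/
def IsWickProduct (P : Measure Ω) (B : T → Ω → ℝ) (X Y Z : Ω → ℝ) : Prop :=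
  IsL2Functional P B X ∧ IsL2Functional P B Y ∧ IsL2Functional P B Z ∧
    ∀ Ψ ∈ Submodule.span ℝ (Set.range B),
      ∫ ω, Z ω * wickExp P Ψ ω ∂P =
        (∫ ω, X ω * wickExp P Ψ ω ∂P) * ∫ ω, Y ω * wickExp P Ψ ω ∂P

open Classical in
/-- The Wick product `X ⋄ Y` (a version of it: it is unique up to almost sure equality), with
value `0` if it does not exist in `L²(Ω, σ(B), P)`. -/
def wick (P : Measure Ω) (B : T → Ω → ℝ) (X Y : Ω → ℝ) : Ω → ℝ :=
  if h : ∃ Z, IsWickProduct P B X Y Z then h.choose else 0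

/-- The Wick powers: `Φ^{⋄ 0} = 1`, `Φ^{⋄ 1} = Φ` and `Φ^{⋄ (k+1)} = Φ^{⋄ k} ⋄ Φ`. -/
def wickPow (P : Measure Ω) (B : T → Ω → ℝ) (Φ : Ω → ℝ) : ℕ → Ω → ℝ
  | 0 => fun _ => 1
  | 1 => Φ
  | k + 2 => wick P B (wickPow P B Φ (k + 1)) Φ

end Continuous

end WickFBM

end

/-!
The Walsh functions of the noise are orthonormal, and an `N`-th discrete Wick power of
`∑ i, b i * ξ i` is the `N`-fold product without its terms with a repeated index. Hence
`E[X ^ ⋄N * Y ^ ⋄N]` is `N!` times the sum of `∏ j, b (f j) * c (f j)` over injective `f`, whereas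
`E[X * Y] ^ N` is that sum over all `f`. The defect in (i) is therefore a sum of squares over the
non-injective `f`: it is nonnegative, and small because it contains a factor
`max i, b i ^ 2 = O(n ^ (2 * H - 2))`.

For (ii), the coefficients `b i` are inner products of the kernel with the orthonormal indicators
of the cells of length `1 / n`, so the covariances converge to the inner products of the kernels,
which are the covariances of fractional Brownian motion. On the Gaussian side the Wick powers are
Hermite polynomials, as their S-transforms show, and `E[Φ ^ ⋄N * Ψ ^ ⋄N] = N! * E[Φ * Ψ] ^ N`.
-/

noncomputable section

namespace WickFBM

section WalshFunctions

lemma walsh_mul_walsh {Ω : Type*} {n : ℕ} (x : Fin n → Ω → ℝ) (A B : Finset (Fin n)) (ω : Ω) :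
    walsh x A ω * walsh x B ω =
      ∏ i, x i ω ^ ((if i ∈ A then 1 else 0) + if i ∈ B then 1 else 0) := by
  simp only [walsh, pow_add, Finset.prod_mul_distrib, pow_ite, pow_one, pow_zero,
    Finset.prod_ite_mem, Finset.univ_inter]

variable {Ω : Type*} [MeasurableSpace Ω] {P : Measure Ω}

/-- Independent square-integrable random variables with mean `0` and second moment `1`: exactly
what makes the Walsh functions orthonormal. -/
structure IsStandardIndep {ι : Type*} (P : Measure Ω) (x : ι → Ω → ℝ) : Prop where
  indep : iIndepFun x P
  memLp_two : ∀ i, MemLp (x i) 2 P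
  integral_eq_zero : ∀ i, ∫ ω, x i ω ∂P = 0
  integral_sq_eq_one : ∀ i, ∫ ω, x i ω ^ 2 ∂P = 1

section Bernoulli

variable {ξ : (n : ℕ) → Fin n → Ω → ℝ}

lemma IsBernoulliArray.measurableSet_eq (hξ : IsBernoulliArray P ξ) (n : ℕ) (i : Fin n) (c : ℝ) :
    MeasurableSet {ω | ξ n i ω = c} :=
  hξ.measurable n i (measurableSet_singleton c)

variable [IsProbabilityMeasure P]

lemma IsBernoulliArray.ae_eq_one_or_neg_one (hξ : IsBernoulliArray P ξ) (n : ℕ) (i : Fin n) :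
    ∀ᵐ ω ∂P, ξ n i ω = 1 ∨ ξ n i ω = -1 := by
  have hdisj : Disjoint {ω | ξ n i ω = 1} {ω | ξ n i ω = -1} :=
    Set.disjoint_left.2 fun ω h₁ h₂ => by
      simp only [Set.mem_ofPred_eq] at h₁ h₂
      linarith
  have hP : P ({ω | ξ n i ω = 1} ∪ {ω | ξ n i ω = -1}) = 1 := by
    rw [measure_union hdisj (hξ.measurableSet_eq n i _), hξ.prob_one, hξ.prob_neg_one,
      ENNReal.add_halves]
  exact (mem_ae_iff_prob_eq_one
    ((hξ.measurableSet_eq n i _).union (hξ.measurableSet_eq n i _))).2 hP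

lemma IsBernoulliArray.integral_eq_zero (hξ : IsBernoulliArray P ξ) (n : ℕ) (i : Fin n) :
    ∫ ω, ξ n i ω ∂P = 0 := by
  have hm := hξ.measurableSet_eq n i
  have h : ξ n i =ᵐ[P] fun ω => {ω | ξ n i ω = 1}.indicator (fun _ => (1 : ℝ)) ω
      - {ω | ξ n i ω = -1}.indicator (fun _ => (1 : ℝ)) ω := by
    filter_upwards [hξ.ae_eq_one_or_neg_one n i] with ω hω
    rcases hω with h | h <;> norm_num [Set.indicator, h]
  rw [integral_congr_ae h, integral_sub ((integrable_const _).indicator (hm _))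
    ((integrable_const _).indicator (hm _)), integral_indicator_const _ (hm _),
    integral_indicator_const _ (hm _), measureReal_def, measureReal_def, hξ.prob_one,
    hξ.prob_neg_one, sub_self]

lemma IsBernoulliArray.isStandardIndep (hξ : IsBernoulliArray P ξ) (n : ℕ) :
    IsStandardIndep P (ξ n) where
  indep := hξ.indep n
  memLp_two i := MemLp.of_bound (hξ.measurable n i).aestronglyMeasurable 1 <| by
    filter_upwards [hξ.ae_eq_one_or_neg_one n i] with ω hω
    rcases hω with h | h <;> simp [h]
  integral_eq_zero i := hξ.integral_eq_zero n i
  integral_sq_eq_one i := by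
    have h : (fun ω => ξ n i ω ^ 2) =ᵐ[P] fun _ => 1 := by
      filter_upwards [hξ.ae_eq_one_or_neg_one n i] with ω hω
      rcases hω with h | h <;> simp [h]
    simp [integral_congr_ae h]

end Bernoulli

lemma integrable_fun_prod_comp_of_iIndepFun {ι : Type*} [Fintype ι] {x : ι → Ω → ℝ}
    (hx : iIndepFun x P) (hm : ∀ i, AEMeasurable (x i) P) {f : ι → ℝ → ℝ}
    (hf : ∀ i, Integrable (f i) (P.map (x i))) :
    Integrable (fun ω => ∏ i, f i (x i ω)) P := by
  have := hx.isProbabilityMeasure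
  have (i : ι) : IsProbabilityMeasure (P.map (x i)) := Measure.isProbabilityMeasure_map (hm i)
  have h := Integrable.fintype_prod hf
  rw [← hx.map_fun_eq_pi_map hm] at h
  exact h.comp_aemeasurable (aemeasurable_pi_lambda _ hm)

variable {n : ℕ} {x : Fin n → Ω → ℝ}

lemma IsStandardIndep.integrable_walsh_mul_walsh (hx : IsStandardIndep P x)
    (A B : Finset (Fin n)) : Integrable (fun ω => walsh x A ω * walsh x B ω) P := by
  have := hx.indep.isProbabilityMeasure
  have hm (i : Fin n) : AEMeasurable (x i) P := (hx.memLp_two i).aestronglyMeasurable.aemeasurable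
  simp only [walsh_mul_walsh]
  refine integrable_fun_prod_comp_of_iIndepFun
    (f := fun i v => v ^ ((if i ∈ A then 1 else 0) + if i ∈ B then 1 else 0))
    hx.indep hm fun i => ?_
  rw [integrable_map_measure (by fun_prop) (hm i)]
  split_ifs
  · simpa [Function.comp_def, one_add_one_eq_two] using (hx.memLp_two i).integrable_sq
  · simpa [Function.comp_def] using (hx.memLp_two i).integrable (by norm_num)
  · simpa [Function.comp_def] using (hx.memLp_two i).integrable (by norm_num)
  · simp [Function.comp_def]

lemma IsStandardIndep.integral_walsh_mul_walsh (hx : IsStandardIndep P x)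
    (A B : Finset (Fin n)) :
    ∫ ω, walsh x A ω * walsh x B ω ∂P = if A = B then 1 else 0 := by
  have := hx.indep.isProbabilityMeasure
  have hfactor (i : Fin n) :
      ∫ ω, x i ω ^ ((if i ∈ A then 1 else 0) + if i ∈ B then 1 else 0) ∂P =
        if i ∈ A ↔ i ∈ B then 1 else 0 := by
    by_cases hA : i ∈ A <;> by_cases hB : i ∈ B <;>
      simp [hA, hB, one_add_one_eq_two, hx.integral_eq_zero, hx.integral_sq_eq_one]
  simp only [walsh_mul_walsh]
  rw [hx.indep.integral_fun_prod_comp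
    (f := fun i v => v ^ ((if i ∈ A then 1 else 0) + if i ∈ B then 1 else 0))
    (fun i => (hx.memLp_two i).aestronglyMeasurable.aemeasurable) (fun i => by fun_prop)]
  simp only [hfactor, Fintype.prod_ite_zero, Finset.prod_const_one, Finset.ext_iff]

lemma IsStandardIndep.integral_sum_mul_sum_walsh (hx : IsStandardIndep P x)
    (c d : Finset (Fin n) → ℝ) :
    ∫ ω, (∑ A, c A * walsh x A ω) * (∑ B, d B * walsh x B ω) ∂P = ∑ A, c A * d A := by
  have hint (A B : Finset (Fin n)) :
      Integrable (fun ω => c A * d B * (walsh x A ω * walsh x B ω)) P :=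
    (hx.integrable_walsh_mul_walsh A B).const_mul _
  simp only [Finset.sum_mul_sum, mul_mul_mul_comm]
  rw [integral_finsetSum _ fun A _ => integrable_finsetSum _ fun B _ => hint A B]
  refine Finset.sum_congr rfl fun A _ => ?_
  rw [integral_finsetSum _ fun B _ => hint A B]
  simp [integral_const_mul, hx.integral_walsh_mul_walsh]

lemma IsStandardIndep.walshCoeff_sum (hx : IsStandardIndep P x)
    (c : Finset (Fin n) → ℝ) (A : Finset (Fin n)) :
    walshCoeff P x (fun ω => ∑ B, c B * walsh x B ω) A = c A := by
  simpa [walshCoeff] using hx.integral_sum_mul_sum_walsh c (fun B => if B = A then 1 else 0)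

end WalshFunctions

section WickPowersOfLinearForms

/-- The Walsh coefficients of the `N`-th discrete Wick power of the linear form `∑ i, b i * x i`. -/
def wickPowCoeff (b : Fin n → ℝ) (N : ℕ) (C : Finset (Fin n)) : ℝ :=
  if C.card = N then (N.factorial : ℝ) * ∏ i ∈ C, b i else 0

lemma sum_wickPowCoeff_one_mul_walsh {Ω : Type*} {n : ℕ} (x : Fin n → Ω → ℝ) (b : Fin n → ℝ)
    (ω : Ω) :
    ∑ A, wickPowCoeff b 1 A * walsh x A ω = ∑ i, b i * x i ω := by
  simp only [wickPowCoeff, walsh, ite_mul, zero_mul, ← Finset.sum_filter]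
  rw [← Finset.powerset_univ, ← Finset.powersetCard_eq_filter, Finset.powersetCard_one,
    Finset.sum_map]
  simp

variable {Ω : Type*} [MeasurableSpace Ω] {P : Measure Ω} {n : ℕ} {x : Fin n → Ω → ℝ}

lemma card_partitions_with_singleton (C : Finset (Fin n)) :
    (Finset.univ.filter fun p : Finset (Fin n) × Finset (Fin n) =>
      (p.1 ∪ p.2 = C ∧ p.1 ∩ p.2 = ∅) ∧ p.2.card = 1).card = C.card := by
  symm
  refine Finset.card_bij (fun i _ => (C.erase i, {i})) (fun i hi => ?_)
    (fun i _ j _ hij => by simpa using (Prod.mk.inj hij).2) ?_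
  · have : C.erase i ∪ {i} = C := by
      rw [Finset.union_comm, ← Finset.insert_eq, Finset.insert_erase hi]
    simp [this]
  · rintro ⟨A, B⟩ hp
    simp only [Finset.mem_filter_univ] at hp
    obtain ⟨⟨rfl, hd⟩, hB⟩ := hp
    obtain ⟨i, rfl⟩ := Finset.card_eq_one.1 hB
    have hi : i ∉ A := by simpa [← Finset.disjoint_iff_inter_eq_empty] using hd
    exact ⟨i, by simp, by simp [Finset.union_comm A, hi]⟩

lemma sum_wickPowCoeff_mul_wickPowCoeff_one (b : Fin n → ℝ) (N : ℕ) (C : Finset (Fin n)) :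
    ∑ p : Finset (Fin n) × Finset (Fin n) with p.1 ∪ p.2 = C ∧ p.1 ∩ p.2 = ∅,
      wickPowCoeff b N p.1 * wickPowCoeff b 1 p.2 = wickPowCoeff b (N + 1) C := by
  have hterm (p : Finset (Fin n) × Finset (Fin n)) (hC : p.1 ∪ p.2 = C) (hd : p.1 ∩ p.2 = ∅) :
      wickPowCoeff b N p.1 * wickPowCoeff b 1 p.2 = if p.2.card = 1 then
        (if C.card = N + 1 then (N.factorial : ℝ) * ∏ i ∈ C, b i else 0) else 0 := by
    have hd' : Disjoint p.1 p.2 := Finset.disjoint_iff_inter_eq_empty.2 hd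
    rw [← hC, Finset.card_union_of_disjoint hd', Finset.prod_union hd']
    by_cases hB : p.2.card = 1 <;> by_cases hA : p.1.card = N <;>
      simp [wickPowCoeff, hA, hB, mul_assoc]
  rw [Finset.sum_congr rfl fun p hp => hterm p (Finset.mem_filter.1 hp).2.1
      (Finset.mem_filter.1 hp).2.2, ← Finset.sum_filter, Finset.filter_filter, Finset.sum_const,
    card_partitions_with_singleton, wickPowCoeff, nsmul_eq_mul]
  split_ifs with hC
  · rw [hC, Nat.factorial_succ]
    push_cast
    ring
  · simp

lemma IsStandardIndep.discreteWickPow_sum (hx : IsStandardIndep P x) (b : Fin n → ℝ) (N : ℕ) :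
    discreteWickPow P x (fun ω => ∑ i, b i * x i ω) N =
      fun ω => ∑ C, wickPowCoeff b N C * walsh x C ω := by
  induction N with
  | zero =>
    funext ω
    simp [discreteWickPow, wickPowCoeff, walsh]
  | succ N ih =>
    funext ω
    rw [discreteWickPow, ih, discreteWick]
    simp only [← sum_wickPowCoeff_one_mul_walsh, hx.walshCoeff_sum,
      sum_wickPowCoeff_mul_wickPowCoeff_one]

lemma IsStandardIndep.integral_sum_mul_sum (hx : IsStandardIndep P x) (b c : Fin n → ℝ) :
    ∫ ω, (∑ i, b i * x i ω) * (∑ i, c i * x i ω) ∂P = ∑ i, b i * c i := by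
  simp only [← sum_wickPowCoeff_one_mul_walsh, hx.integral_sum_mul_sum_walsh]
  simpa [wickPowCoeff, Finset.prod_mul_distrib, walsh, ← ite_and] using
    sum_wickPowCoeff_one_mul_walsh (fun i (_ : Unit) => c i) b ()

lemma IsStandardIndep.integral_discreteWickPow_sub_sq (hx : IsStandardIndep P x)
    (b c : Fin n → ℝ) (N : ℕ) :
    ∫ ω, (discreteWickPow P x (fun ω => ∑ i, b i * x i ω) N ω
        - discreteWickPow P x (fun ω => ∑ i, c i * x i ω) N ω) ^ 2 ∂P =
      ∑ C, (wickPowCoeff b N C - wickPowCoeff c N C) ^ 2 := by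
  rw [hx.discreteWickPow_sum, hx.discreteWickPow_sum]
  simp only [← Finset.sum_sub_distrib, ← sub_mul, sq, hx.integral_sum_mul_sum_walsh]

end WickPowersOfLinearForms

section SumsOverTuples

variable {ι : Type*} [Fintype ι] [DecidableEq ι]

lemma card_injective_image_eq {N : ℕ} {C : Finset ι} (hC : C.card = N) :
    (Finset.univ.filter fun g : Fin N → ι =>
      Function.Injective g ∧ Finset.univ.image g = C).card = N.factorial := by
  calc _ = (Finset.univ : Finset (Fin N ↪ C)).card := by
        symm
        refine Finset.card_bij (fun e _ j => (e j : ι)) (fun e _ => ?_)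
          (fun e _ e' _ h => by ext j; exact congrFun h j) fun g hg => ?_
        · have he : Function.Injective fun j => (e j : ι) :=
            Subtype.val_injective.comp e.injective
          refine Finset.mem_filter_univ _ |>.2 ⟨he, Finset.eq_of_subset_of_card_le ?_ ?_⟩
          · exact Finset.image_subset_iff.2 fun j _ => (e j).2
          · rw [Finset.card_image_of_injective _ he, Finset.card_fin, hC]
        · obtain ⟨hinj, himage⟩ := Finset.mem_filter_univ _ |>.1 hg
          have hmem (j : Fin N) : g j ∈ C := himage ▸ Finset.mem_image_of_mem g (Finset.mem_univ j)
          exact ⟨⟨fun j => ⟨g j, hmem j⟩, fun j k h => hinj (congrArg Subtype.val h)⟩,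
            Finset.mem_univ _, rfl⟩
    _ = N.factorial := by
        rw [Finset.card_univ, Fintype.card_embedding_eq, Fintype.card_coe, Fintype.card_fin, hC,
          Nat.descFactorial_self]

lemma sum_injective_comp_image (N : ℕ) (f : Finset ι → ℝ) :
    ∑ g : Fin N → ι with Function.Injective g, f (Finset.univ.image g) =
      N.factorial * ∑ C : Finset ι with C.card = N, f C := by
  have hmaps : ∀ g ∈ Finset.univ.filter (Function.Injective (α := Fin N) (β := ι)),
      Finset.univ.image g ∈ Finset.univ.filter fun C : Finset ι => C.card = N := fun g hg => by
    simp [Finset.card_image_of_injective _ (Finset.mem_filter_univ _ |>.1 hg)]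
  rw [← Finset.sum_fiberwise_of_maps_to hmaps, Finset.mul_sum]
  refine Finset.sum_congr rfl fun C hC => ?_
  rw [Finset.sum_congr rfl fun g hg => congrArg f (Finset.mem_filter.1 hg).2, Finset.sum_const,
    Finset.filter_filter, card_injective_image_eq (Finset.mem_filter.1 hC).2, nsmul_eq_mul]

lemma sum_not_injective_cons_le {x : ι → ℝ} {M : ℝ} (hx : ∀ i, 0 ≤ x i) (hM : ∀ i, x i ≤ M)
    {N : ℕ} (g : Fin N → ι) :
    ∑ i with ¬ Function.Injective (Fin.cons i g : Fin (N + 1) → ι), x i ≤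
      (if Function.Injective g then 0 else ∑ i, x i) + N * M := by
  simp only [Fin.cons_injective_iff]
  split_ifs with hg
  · calc ∑ i with ¬ (i ∉ Set.range g ∧ Function.Injective g), x i
        = ∑ i ∈ Finset.univ.image g, x i := by
          congr 1
          ext i
          simp [hg]
      _ ≤ (Finset.univ.image g).card • M := Finset.sum_le_card_nsmul _ _ _ fun i _ => hM i
      _ = 0 + N * M := by
          rw [Finset.card_image_of_injective _ hg, Finset.card_fin, nsmul_eq_mul, zero_add]
  · have hNM : 0 ≤ N * M := by
      rcases N with _ | N
      · simp
      · exact mul_nonneg (Nat.cast_nonneg _) ((hx (g 0)).trans (hM _))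
    simpa [hg] using hNM

lemma sum_not_injective_prod_le {x : ι → ℝ} {M : ℝ} (hx : ∀ i, 0 ≤ x i) (hM : ∀ i, x i ≤ M)
    (N : ℕ) :
    ∑ g : Fin (N + 1) → ι with ¬ Function.Injective g, ∏ j, x (g j) ≤
      (N + 1) * N / 2 * M * (∑ i, x i) ^ N := by
  induction N with
  | zero => simp [Function.injective_of_subsingleton]
  | succ N ih =>
    have hprod (g : Fin (N + 1) → ι) : 0 ≤ ∏ j, x (g j) := Finset.prod_nonneg fun j _ => hx _
    calc ∑ g : Fin (N + 2) → ι with ¬ Function.Injective g, ∏ j, x (g j)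
        = ∑ g : Fin (N + 1) → ι, (∑ i with ¬ Function.Injective (Fin.cons i g : Fin (N + 2) → ι),
            x i) * ∏ j, x (g j) := by
          rw [Finset.sum_filter, ← (Fin.consEquiv fun _ : Fin (N + 2) => ι).sum_comp,
            Fintype.sum_prod_type_right]
          refine Finset.sum_congr rfl fun g _ => ?_
          simp [Fin.consEquiv, Fin.prod_univ_succ (n := N + 1), Finset.sum_mul, Finset.sum_filter]
      _ ≤ ∑ g : Fin (N + 1) → ι, ((if Function.Injective g then 0 else ∑ i, x i) +
            ((N + 1 : ℕ) : ℝ) * M) * ∏ j, x (g j) := by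
          gcongr with g
          · exact hprod g
          · exact sum_not_injective_cons_le hx hM g
      _ = (∑ i, x i) * ∑ g : Fin (N + 1) → ι with ¬ Function.Injective g, ∏ j, x (g j) +
            (N + 1) * M * (∑ i, x i) ^ (N + 1) := by
          simp only [add_mul, Finset.sum_add_distrib, Fintype.sum_pow, Finset.mul_sum, ite_mul,
            zero_mul, Finset.sum_filter, mul_ite, mul_zero, ite_not, Nat.cast_add, Nat.cast_one]
      _ ≤ (∑ i, x i) * ((N + 1) * N / 2 * M * (∑ i, x i) ^ N) +
            (N + 1) * M * (∑ i, x i) ^ (N + 1) := by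
          gcongr
          exact Finset.sum_nonneg fun i _ => hx i
      _ = ((N + 1 : ℕ) + 1) * (N + 1 : ℕ) / 2 * M * (∑ i, x i) ^ (N + 1) := by
          push_cast
          ring

lemma pow_sum_sub_sum_injective_eq (b c : ι → ℝ) (N : ℕ) :
    (∑ i, b i ^ 2) ^ N + (∑ i, c i ^ 2) ^ N - 2 * (∑ i, b i * c i) ^ N
      - ∑ g : Fin N → ι with Function.Injective g, (∏ j, b (g j) - ∏ j, c (g j)) ^ 2 =
      ∑ g : Fin N → ι with ¬ Function.Injective g, (∏ j, b (g j) - ∏ j, c (g j)) ^ 2 := by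
  rw [sub_eq_iff_eq_add', Finset.sum_filter_add_sum_filter_not]
  simp only [Fintype.sum_pow, Finset.prod_mul_distrib, Finset.prod_pow, sub_sq',
    Finset.sum_add_distrib, Finset.sum_sub_distrib, Finset.mul_sum, mul_assoc]

lemma pow_sum_sub_sum_injective_mem_Icc {b c : ι → ℝ} {M : ℝ} (hc : ∀ i, 0 ≤ c i)
    (hcb : ∀ i, c i ≤ b i) (hM : ∀ i, b i ^ 2 ≤ M) (N : ℕ) :
    (∑ i, b i ^ 2) ^ (N + 1) + (∑ i, c i ^ 2) ^ (N + 1) - 2 * (∑ i, b i * c i) ^ (N + 1)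
      - ∑ g : Fin (N + 1) → ι with Function.Injective g, (∏ j, b (g j) - ∏ j, c (g j)) ^ 2 ∈
      Set.Icc 0 ((N + 1) * N / 2 * M * (∑ i, b i ^ 2) ^ N) := by
  rw [pow_sum_sub_sum_injective_eq]
  refine ⟨Finset.sum_nonneg fun g _ => sq_nonneg _, ?_⟩
  refine (Finset.sum_le_sum fun g _ => ?_).trans
    (sum_not_injective_prod_le (fun i => sq_nonneg (b i)) hM N)
  have h₀ : 0 ≤ ∏ j, c (g j) := Finset.prod_nonneg fun j _ => hc _
  have h₁ : ∏ j, c (g j) ≤ ∏ j, b (g j) := Finset.prod_le_prod (fun j _ => hc _) fun j _ => hcb _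
  rw [Finset.prod_pow]
  exact pow_le_pow_left₀ (sub_nonneg.2 h₁) (sub_le_self _ h₀) 2

lemma sum_wickPowCoeff_sub_sq {n : ℕ} (b c : Fin n → ℝ) (N : ℕ) :
    ∑ C, (wickPowCoeff b N C - wickPowCoeff c N C) ^ 2 = N.factorial *
      ∑ g : Fin N → Fin n with Function.Injective g, (∏ j, b (g j) - ∏ j, c (g j)) ^ 2 := by
  have himage (g : Fin N → Fin n) (hg : Function.Injective g) (a : Fin n → ℝ) :
      ∏ j, a (g j) = ∏ i ∈ Finset.univ.image g, a i :=
    (Finset.prod_image hg.injOn).symm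
  have hsum : ∑ g : Fin N → Fin n with Function.Injective g, (∏ j, b (g j) - ∏ j, c (g j)) ^ 2 =
      N.factorial * ∑ C : Finset (Fin n) with C.card = N, (∏ i ∈ C, b i - ∏ i ∈ C, c i) ^ 2 := by
    rw [← sum_injective_comp_image]
    refine Finset.sum_congr rfl fun g hg => ?_
    have hg' := Finset.mem_filter_univ _ |>.1 hg
    rw [himage g hg', himage g hg']
  rw [hsum, Finset.sum_filter, Finset.mul_sum, Finset.mul_sum]
  refine Finset.sum_congr rfl fun C _ => ?_
  unfold wickPowCoeff
  split_ifs <;> ring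

end SumsOverTuples

section Kernel

variable {H s t x : ℝ}

lemma cH_nonneg (H : ℝ) : 0 ≤ cH H := Real.sqrt_nonneg _

lemma integral_sub_rpow {r : ℝ} (hr : -1 < r) (x b : ℝ) :
    ∫ u in x..b, (u - x) ^ r = (b - x) ^ (r + 1) / (r + 1) := by
  rw [intervalIntegral.integral_comp_sub_right (fun u => u ^ r) x, integral_rpow (Or.inl hr),
    sub_self, Real.zero_rpow (by linarith), sub_zero]

lemma intervalIntegrable_sub_rpow {r : ℝ} (hr : -1 < r) (x a b : ℝ) :
    IntervalIntegrable (fun u => (u - x) ^ r) volume a b := by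
  simpa using
    (intervalIntegral.intervalIntegrable_rpow' (a := a - x) (b := b - x) hr).comp_sub_right x

lemma intervalIntegrable_kernel_integrand (hH : 1 / 2 < H) (x t : ℝ) :
    IntervalIntegrable (fun u => u ^ (H - 1 / 2) * (u - x) ^ (H - 3 / 2)) volume x t :=
  (intervalIntegrable_sub_rpow (by linarith) x x t).continuousOn_mul
    (Real.continuous_rpow_const (by linarith)).continuousOn

/-- The derivative in `u` of the kernel `z_H(u, x)`, extended by `0` outside `0 < x < u`. -/
def kernelDensity (H u x : ℝ) : ℝ :=
  if 0 < x ∧ x < u then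
    cH H * (H - 1 / 2) * x ^ (1 / 2 - H) * (u ^ (H - 1 / 2) * (u - x) ^ (H - 3 / 2))
  else 0

lemma kernelDensity_nonneg (hH : 1 / 2 < H) (u x : ℝ) : 0 ≤ kernelDensity H u x := by
  unfold kernelDensity
  split_ifs with h
  · have := cH_nonneg H
    have : 0 ≤ H - 1 / 2 := by linarith
    have : 0 ≤ u - x := by linarith
    have : 0 ≤ u := by linarith
    have := h.1
    positivity
  · rfl

@[fun_prop]
lemma measurable_kernelDensity (H : ℝ) :
    Measurable fun p : ℝ × ℝ => kernelDensity H p.1 p.2 :=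
  Measurable.ite ((measurableSet_lt measurable_const measurable_snd).inter
    (measurableSet_lt measurable_snd measurable_fst)) (by fun_prop) measurable_const

lemma kernelDensity_eq_indicator (hx : 0 < x) :
    (fun u => kernelDensity H u x) = (Set.Ioi x).indicator fun u =>
      cH H * (H - 1 / 2) * x ^ (1 / 2 - H) * (u ^ (H - 1 / 2) * (u - x) ^ (H - 3 / 2)) := by
  funext u
  simp only [kernelDensity, Set.indicator_apply, Set.mem_Ioi, hx, true_and]

lemma Ioi_inter_Ioc_zero (hx : 0 < x) (t : ℝ) : Set.Ioi x ∩ Set.Ioc 0 t = Set.Ioc x t := by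
  rw [Set.inter_comm, Set.Ioc_inter_Ioi, max_eq_right hx.le]

lemma integrableOn_kernelDensity (hH : 1 / 2 < H) (hx : 0 < x) (t : ℝ) :
    IntegrableOn (fun u => kernelDensity H u x) (Set.Ioc 0 t) := by
  rw [kernelDensity_eq_indicator hx, IntegrableOn, integrable_indicator_iff measurableSet_Ioi,
    IntegrableOn, Measure.restrict_restrict measurableSet_Ioi, Ioi_inter_Ioc_zero hx]
  exact (intervalIntegrable_kernel_integrand hH x t).1.const_mul _

lemma kernel_of_lt (h : t < x) : kernel H t x = 0 := by
  simp [kernel, not_le.2 h]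

lemma kernel_eq_setIntegral (hx : 0 < x) (t : ℝ) :
    kernel H t x = ∫ u in Set.Ioc 0 t, kernelDensity H u x := by
  rw [kernelDensity_eq_indicator hx, integral_indicator measurableSet_Ioi,
    Measure.restrict_restrict measurableSet_Ioi, Ioi_inter_Ioc_zero hx, integral_const_mul]
  rcases le_or_gt x t with h | h
  · rw [kernel, if_pos h, intervalIntegral.integral_of_le h]
  · simp [kernel_of_lt h, Set.Ioc_eq_empty h.not_gt]

lemma ofReal_kernel (hH : 1 / 2 < H) (hx : 0 < x) (t : ℝ) :
    ENNReal.ofReal (kernel H t x) =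
      ∫⁻ u in Set.Ioc 0 t, ENNReal.ofReal (kernelDensity H u x) := by
  rw [kernel_eq_setIntegral hx, ofReal_integral_eq_lintegral_ofReal
    (integrableOn_kernelDensity hH hx t) (ae_of_all _ fun u => kernelDensity_nonneg hH u x)]

lemma kernel_nonneg (hH : 1 / 2 < H) (hx : 0 < x) (t : ℝ) : 0 ≤ kernel H t x := by
  rw [kernel_eq_setIntegral hx]
  exact integral_nonneg fun u => kernelDensity_nonneg hH u x

lemma kernel_mono (hH : 1 / 2 < H) (hx : 0 < x) (hst : s ≤ t) :
    kernel H s x ≤ kernel H t x := by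
  rw [kernel_eq_setIntegral hx, kernel_eq_setIntegral hx]
  exact setIntegral_mono_set (integrableOn_kernelDensity hH hx t)
    (ae_of_all _ fun u => kernelDensity_nonneg hH u x)
    (Set.Ioc_subset_Ioc_right hst).eventuallyLE

lemma kernel_le (hH : 1 / 2 < H) (hx : 0 < x) (ht : t ≤ 1) :
    kernel H t x ≤ cH H * x ^ (1 / 2 - H) := by
  have hc := cH_nonneg H
  have hH₀ : 0 < H - 1 / 2 := by linarith
  rcases le_or_gt x t with hxt | hxt
  swap
  · rw [kernel_of_lt hxt]
    positivity
  have hint : ∫ u in x..t, u ^ (H - 1 / 2) * (u - x) ^ (H - 3 / 2) ≤ (H - 1 / 2)⁻¹ := by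
    calc _ ≤ ∫ u in x..t, (u - x) ^ (H - 3 / 2) := by
          refine intervalIntegral.integral_mono_on hxt (intervalIntegrable_kernel_integrand hH x t)
            (intervalIntegrable_sub_rpow (by linarith) x x t) fun u hu => ?_
          exact mul_le_of_le_one_left (Real.rpow_nonneg (sub_nonneg.2 hu.1) _)
            (Real.rpow_le_one (hx.le.trans hu.1) (hu.2.trans ht) hH₀.le)
      _ = (t - x) ^ (H - 1 / 2) / (H - 1 / 2) := by
          rw [integral_sub_rpow (by linarith), show H - 3 / 2 + 1 = H - 1 / 2 by ring]
      _ ≤ (H - 1 / 2)⁻¹ := by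
          rw [inv_eq_one_div]
          gcongr
          exact Real.rpow_le_one (by linarith) (by linarith) hH₀.le
  calc kernel H t x ≤ cH H * (H - 1 / 2) * x ^ (1 / 2 - H) * (H - 1 / 2)⁻¹ := by
        rw [kernel, if_pos hxt]
        gcongr
    _ = cH H * x ^ (1 / 2 - H) := by
        rw [mul_right_comm, mul_inv_cancel_right₀ hH₀.ne']

lemma aestronglyMeasurable_kernel (H t : ℝ) :
    AEStronglyMeasurable (kernel H t) (volume.restrict (Set.Ioi 0)) := by
  have hm : StronglyMeasurable fun x => ∫ u in Set.Ioc 0 t, kernelDensity H u x :=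
    (measurable_kernelDensity H).stronglyMeasurable.integral_prod_left
  refine hm.aestronglyMeasurable.congr ?_
  filter_upwards [ae_restrict_mem measurableSet_Ioi] with x hx
  exact (kernel_eq_setIntegral hx t).symm

end Kernel

section BetaIntegral

variable {v w : ℝ}

/-- The fractional linear map sending `0, v, w` to `0, 1, ∞`. -/
def betaSubst (v w x : ℝ) : ℝ :=
  x * (w - v) / (v * (w - x))

lemma one_sub_betaSubst {x : ℝ} (hv : v ≠ 0) (hx : x ≠ w) :
    1 - betaSubst v w x = w * (v - x) / (v * (w - x)) := by
  have : w - x ≠ 0 := sub_ne_zero.2 hx.symm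
  rw [betaSubst]
  field_simp
  ring

lemma hasDerivAt_betaSubst {x : ℝ} (hv : v ≠ 0) (hx : x ≠ w) :
    HasDerivAt (betaSubst v w) (w * (w - v) / (v * (w - x) ^ 2)) x := by
  have hwx : w - x ≠ 0 := sub_ne_zero.2 hx.symm
  refine (((hasDerivAt_id x).mul_const (w - v)).div
    (((hasDerivAt_id x).const_sub w).const_mul v) (mul_ne_zero hv hwx)).congr_deriv ?_
  simp only [id]
  field_simp
  ring

lemma bijOn_betaSubst (hv : 0 < v) (hvw : v < w) :
    Set.BijOn (betaSubst v w) (Set.Ioo 0 v) (Set.Ioo 0 1) := by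
  have hwv : 0 < w - v := sub_pos.2 hvw
  have hw : 0 < w := hv.trans hvw
  refine Set.InvOn.bijOn (f' := fun q => q * v * w / (w - v + q * v)) ⟨?_, ?_⟩ ?_ ?_
  · rintro x ⟨hx₀, hxv⟩
    have hwx : 0 < w - x := by linarith
    have hden : w - v + betaSubst v w x * v = w * (w - v) / (w - x) := by
      rw [betaSubst]
      field_simp
      ring
    change betaSubst v w x * v * w / (w - v + betaSubst v w x * v) = x
    rw [hden, betaSubst]
    field_simp
  · rintro q ⟨hq₀, -⟩
    have : 0 < w - v + q * v := by positivity
    have hsub : w - q * v * w / (w - v + q * v) = w * (w - v) / (w - v + q * v) := by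
      field_simp
      ring
    simp only [betaSubst, hsub]
    field_simp
  · rintro x ⟨hx₀, hxv⟩
    have : 0 < w - x := by linarith
    have : 0 < v - x := by linarith
    have h := one_sub_betaSubst hv.ne' (hxv.trans hvw).ne
    refine ⟨by unfold betaSubst; positivity, sub_pos.1 ?_⟩
    rw [h]
    positivity
  · rintro q ⟨hq₀, hq₁⟩
    have hden : 0 < w - v + q * v := by positivity
    refine ⟨by positivity, (div_lt_iff₀ hden).2 ?_⟩
    nlinarith [mul_pos hv (mul_pos hwv (sub_pos.2 hq₁))]

lemma lintegral_rpow_mul_one_sub_rpow {α β : ℝ} (hα : 0 < α) (hβ : 0 < β) :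
    ∫⁻ q in Set.Ioo (0 : ℝ) 1, ENNReal.ofReal (q ^ (α - 1) * (1 - q) ^ (β - 1)) =
      ENNReal.ofReal (beta α β) := by
  have hB := beta_pos hα hβ
  have h := lintegral_betaPDF_eq_one hα hβ
  simp only [lintegral_betaPDF, mul_assoc,
    ENNReal.ofReal_mul (show 0 ≤ 1 / beta α β by positivity)] at h
  rw [lintegral_const_mul' _ _ ENNReal.ofReal_ne_top] at h
  rw [ENNReal.eq_inv_of_mul_eq_one_left ((mul_comm _ _).trans h),
    ← ENNReal.ofReal_inv_of_pos (by positivity), one_div, inv_inv]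

lemma deriv_mul_beta_integrand_betaSubst {x : ℝ} (α β : ℝ) (hx : 0 < x) (hxv : x < v)
    (hvw : v < w) :
    w * (w - v) / (v * (w - x) ^ 2) *
        (betaSubst v w x ^ (α - 1) * (1 - betaSubst v w x) ^ (β - 1)) =
      w ^ β * (w - v) ^ α / v ^ (α + β - 1) *
        (x ^ (α - 1) * (v - x) ^ (β - 1) * (w - x) ^ (-(α + β))) := by
  have hv : 0 < v := hx.trans hxv
  have hw : 0 < w := hv.trans hvw
  have hwv : 0 < w - v := sub_pos.2 hvw
  have hvx : 0 < v - x := sub_pos.2 hxv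
  have hwx : 0 < w - x := by linarith
  rw [one_sub_betaSubst hv.ne' (hxv.trans hvw).ne, betaSubst]
  refine Real.log_injOn_pos (Set.mem_Ioi.2 (by positivity)) (Set.mem_Ioi.2 (by positivity)) ?_
  simp (disch := positivity) only [Real.log_mul, Real.log_div, Real.log_rpow, Real.log_pow]
  push_cast
  ring

lemma lintegral_rpow_mul_sub_rpow_mul_sub_rpow {α β : ℝ} (hα : 0 < α) (hβ : 0 < β) (hv : 0 < v)
    (hvw : v < w) :
    ∫⁻ x in Set.Ioo 0 v,
        ENNReal.ofReal (x ^ (α - 1) * (v - x) ^ (β - 1) * (w - x) ^ (-(α + β))) =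
      ENNReal.ofReal (beta α β * (v ^ (α + β - 1) / (w ^ β * (w - v) ^ α))) := by
  have hw : 0 < w := hv.trans hvw
  have : 0 < w - v := sub_pos.2 hvw
  set K := w ^ β * (w - v) ^ α / v ^ (α + β - 1)
  have hK₀ : 0 < K := by positivity
  have hbij := bijOn_betaSubst hv hvw
  have hsubst := lintegral_image_eq_lintegral_abs_deriv_mul measurableSet_Ioo
    (fun x hx => (hasDerivAt_betaSubst hv.ne' (hx.2.trans hvw).ne).hasDerivWithinAt) hbij.injOn
    fun q => ENNReal.ofReal (q ^ (α - 1) * (1 - q) ^ (β - 1))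
  have hintegrand : Set.EqOn
      (fun x => ENNReal.ofReal |w * (w - v) / (v * (w - x) ^ 2)| *
        ENNReal.ofReal (betaSubst v w x ^ (α - 1) * (1 - betaSubst v w x) ^ (β - 1)))
      (fun x => ENNReal.ofReal K *
        ENNReal.ofReal (x ^ (α - 1) * (v - x) ^ (β - 1) * (w - x) ^ (-(α + β))))
      (Set.Ioo 0 v) := fun x hx => by
    simp only [← ENNReal.ofReal_mul (abs_nonneg _), ← ENNReal.ofReal_mul hK₀.le]
    rw [abs_of_nonneg (by positivity), deriv_mul_beta_integrand_betaSubst α β hx.1 hx.2 hvw]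
  rw [hbij.image_eq, lintegral_rpow_mul_one_sub_rpow hα hβ,
    setLIntegral_congr_fun measurableSet_Ioo hintegrand,
    lintegral_const_mul' _ _ ENNReal.ofReal_ne_top] at hsubst
  rw [← inv_div, ← div_eq_mul_inv, ENNReal.ofReal_div_of_pos hK₀,
    ENNReal.eq_div_iff (ENNReal.ofReal_pos.2 hK₀).ne' ENNReal.ofReal_ne_top, hsubst]

end BetaIntegral

section KernelCovariance

variable {H s t : ℝ}

lemma cH_sq_mul_beta (hH : 1 / 2 < H) (hH' : H < 1) :
    (cH H * (H - 1 / 2)) ^ 2 * beta (2 - 2 * H) (H - 1 / 2) = H * (2 * H - 1) := by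
  have hΓ₁ := Real.Gamma_pos_of_pos (s := 3 / 2 - H) (by linarith)
  have hΓ₂ := Real.Gamma_pos_of_pos (s := H - 1 / 2) (by linarith)
  have hΓ₃ := Real.Gamma_pos_of_pos (s := 2 - 2 * H) (by linarith)
  have hH₀ : 0 < H - 1 / 2 := by linarith
  have hΓ : Real.Gamma (H + 1 / 2) = (H - 1 / 2) * Real.Gamma (H - 1 / 2) := by
    rw [← Real.Gamma_add_one hH₀.ne', sub_add, ← sub_neg_eq_add]
    norm_num
  rw [mul_pow, cH, Real.sq_sqrt (by rw [hΓ]; positivity), hΓ, beta,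
    show 2 - 2 * H + (H - 1 / 2) = 3 / 2 - H by ring,
    show 2 * H - 1 = 2 * (H - 1 / 2) by ring]
  generalize H - 1 / 2 = a at *
  generalize 3 / 2 - H = b at *
  generalize 2 - 2 * H = c at *
  field_simp

lemma kernelDensity_mul_kernelDensity {v w x : ℝ} (hx : 0 < x) (hxv : x < v) (hxw : x < w) :
    kernelDensity H v x * kernelDensity H w x =
      (cH H * (H - 1 / 2)) ^ 2 * (v * w) ^ (H - 1 / 2) *
        (x ^ (2 - 2 * H - 1) * (v - x) ^ (H - 1 / 2 - 1) *
          (w - x) ^ (-(2 - 2 * H + (H - 1 / 2)))) := by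
  rw [show 2 - 2 * H - 1 = (1 / 2 - H) + (1 / 2 - H) by ring, Real.rpow_add hx,
    Real.mul_rpow (hx.trans hxv).le (hx.trans hxw).le,
    show H - 1 / 2 - 1 = H - 3 / 2 by ring,
    show -(2 - 2 * H + (H - 1 / 2)) = H - 3 / 2 by ring]
  simp only [kernelDensity, hx, hxv, hxw, and_self, if_true]
  ring

lemma lintegral_kernelDensity_mul_of_lt (hH : 1 / 2 < H) (hH' : H < 1) {v w : ℝ} (hv : 0 < v)
    (hvw : v < w) :
    ∫⁻ x, ENNReal.ofReal (kernelDensity H v x) * ENNReal.ofReal (kernelDensity H w x) =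
      ENNReal.ofReal (H * (2 * H - 1) * |v - w| ^ (2 * H - 2)) := by
  have hw : 0 < w := hv.trans hvw
  have hwv : 0 < w - v := sub_pos.2 hvw
  have hsupport : (fun x => ENNReal.ofReal (kernelDensity H v x) *
        ENNReal.ofReal (kernelDensity H w x)) =
      (Set.Ioo 0 v).indicator fun x =>
        ENNReal.ofReal ((cH H * (H - 1 / 2)) ^ 2 * (v * w) ^ (H - 1 / 2)) *
        ENNReal.ofReal (x ^ (2 - 2 * H - 1) * (v - x) ^ (H - 1 / 2 - 1) *
          (w - x) ^ (-(2 - 2 * H + (H - 1 / 2)))) := by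
    funext x
    by_cases hx : x ∈ Set.Ioo 0 v
    · rw [Set.indicator_of_mem hx, ← ENNReal.ofReal_mul (kernelDensity_nonneg hH v x),
        kernelDensity_mul_kernelDensity hx.1 hx.2 (hx.2.trans hvw),
        ENNReal.ofReal_mul (by positivity)]
    · rw [Set.indicator_of_notMem hx, kernelDensity.eq_1 H v, if_neg (by exact hx),
        ENNReal.ofReal_zero, zero_mul]
  rw [hsupport, lintegral_indicator measurableSet_Ioo,
    lintegral_const_mul' _ _ ENNReal.ofReal_ne_top,
    lintegral_rpow_mul_sub_rpow_mul_sub_rpow (by linarith) (by linarith) hv hvw,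
    ← ENNReal.ofReal_mul (by positivity), ← cH_sq_mul_beta hH hH', abs_sub_comm,
    abs_of_pos hwv, Real.mul_rpow hv.le hw.le,
    show 2 - 2 * H + (H - 1 / 2) - 1 = -(H - 1 / 2) by ring, Real.rpow_neg hv.le,
    show 2 - 2 * H = -(2 * H - 2) by ring, Real.rpow_neg hwv.le]
  congr 1
  field_simp

lemma lintegral_kernelDensity_mul (hH : 1 / 2 < H) (hH' : H < 1) {v w : ℝ} (hv : 0 < v)
    (hw : 0 < w) (hvw : v ≠ w) :
    ∫⁻ x, ENNReal.ofReal (kernelDensity H v x) * ENNReal.ofReal (kernelDensity H w x) =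
      ENNReal.ofReal (H * (2 * H - 1) * |v - w| ^ (2 * H - 2)) := by
  rcases hvw.lt_or_gt with h | h
  · exact lintegral_kernelDensity_mul_of_lt hH hH' hv h
  · simpa only [mul_comm, abs_sub_comm] using lintegral_kernelDensity_mul_of_lt hH hH' hw h

lemma setLIntegral_kernel_mul_eq_lintegral_kernelDensity (hH : 1 / 2 < H) (s t : ℝ) :
    ∫⁻ x in Set.Ioi 0, ENNReal.ofReal (kernel H s x) * ENNReal.ofReal (kernel H t x) =
      ∫⁻ w in Set.Ioc 0 s, ∫⁻ v in Set.Ioc 0 t, ∫⁻ x,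
        ENNReal.ofReal (kernelDensity H w x) * ENNReal.ofReal (kernelDensity H v x) := by
  have hκ : Measurable fun p : ℝ × ℝ => ENNReal.ofReal (kernelDensity H p.1 p.2) :=
    (measurable_kernelDensity H).ennreal_ofReal
  have hκ₁ (x : ℝ) : Measurable fun u => ENNReal.ofReal (kernelDensity H u x) :=
    hκ.comp measurable_prodMk_right
  calc _ = ∫⁻ x in Set.Ioi 0, ∫⁻ w in Set.Ioc 0 s, ∫⁻ v in Set.Ioc 0 t,
          ENNReal.ofReal (kernelDensity H w x) * ENNReal.ofReal (kernelDensity H v x) := by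
        refine setLIntegral_congr_fun measurableSet_Ioi fun x hx => ?_
        simp only [ofReal_kernel hH hx, lintegral_const_mul _ (hκ₁ x),
          lintegral_mul_const _ (hκ₁ x)]
    _ = ∫⁻ x, ∫⁻ w in Set.Ioc 0 s, ∫⁻ v in Set.Ioc 0 t,
          ENNReal.ofReal (kernelDensity H w x) * ENNReal.ofReal (kernelDensity H v x) := by
        refine setLIntegral_eq_of_support_subset fun x hx => ?_
        by_contra hx₀
        exact hx (by simp [kernelDensity, show ¬ 0 < x from hx₀])
    _ = ∫⁻ w in Set.Ioc 0 s, ∫⁻ x, ∫⁻ v in Set.Ioc 0 t,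
          ENNReal.ofReal (kernelDensity H w x) * ENNReal.ofReal (kernelDensity H v x) := by
        refine lintegral_lintegral_swap (Measurable.aemeasurable ?_)
        exact Measurable.lintegral_prod_right' (f := fun p : (ℝ × ℝ) × ℝ =>
          ENNReal.ofReal (kernelDensity H p.1.2 p.1.1) *
            ENNReal.ofReal (kernelDensity H p.2 p.1.1)) (by fun_prop)
    _ = _ := by
        refine lintegral_congr fun w => lintegral_lintegral_swap (Measurable.aemeasurable ?_)
        fun_prop

lemma intervalIntegrable_const_sub_rpow {r : ℝ} (hr : -1 < r) (c a b : ℝ) :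
    IntervalIntegrable (fun u => (c - u) ^ r) volume a b := by
  simpa using
    (intervalIntegral.intervalIntegrable_rpow' (a := c - a) (b := c - b) hr).comp_sub_left c

lemma integral_const_sub_rpow {r : ℝ} (hr : -1 < r) (c a b : ℝ) :
    ∫ u in a..b, (c - u) ^ r = ((c - a) ^ (r + 1) - (c - b) ^ (r + 1)) / (r + 1) := by
  rw [intervalIntegral.integral_comp_sub_left (fun u => u ^ r) c, integral_rpow (Or.inl hr)]

lemma abs_sub_rpow_eqOn_left {a c : ℝ} (r : ℝ) (hac : a ≤ c) :
    Set.EqOn (fun u => |u - c| ^ r) (fun u => (c - u) ^ r) (Set.uIcc a c) := fun u hu => by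
  rw [Set.uIcc_of_le hac] at hu
  simp only [abs_of_nonpos (sub_nonpos.2 hu.2), neg_sub]

lemma abs_sub_rpow_eqOn_right {b c : ℝ} (r : ℝ) (hcb : c ≤ b) :
    Set.EqOn (fun u => |u - c| ^ r) (fun u => (u - c) ^ r) (Set.uIcc c b) := fun u hu => by
  rw [Set.uIcc_of_le hcb] at hu
  simp only [abs_of_nonneg (sub_nonneg.2 hu.1)]

lemma intervalIntegrable_abs_sub_rpow_left {r a c : ℝ} (hr : -1 < r) (hac : a ≤ c) :
    IntervalIntegrable (fun u => |u - c| ^ r) volume a c :=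
  (intervalIntegrable_const_sub_rpow hr c a c).congr
    fun _ hu => (abs_sub_rpow_eqOn_left r hac (Set.uIoc_subset_uIcc hu)).symm

lemma intervalIntegrable_abs_sub_rpow_right {r b c : ℝ} (hr : -1 < r) (hcb : c ≤ b) :
    IntervalIntegrable (fun u => |u - c| ^ r) volume c b :=
  (intervalIntegrable_sub_rpow hr c c b).congr
    fun _ hu => (abs_sub_rpow_eqOn_right r hcb (Set.uIoc_subset_uIcc hu)).symm

lemma integral_abs_sub_rpow {r a b c : ℝ} (hr : -1 < r) (hac : a ≤ c) (hcb : c ≤ b) :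
    ∫ u in a..b, |u - c| ^ r = ((c - a) ^ (r + 1) + (b - c) ^ (r + 1)) / (r + 1) := by
  rw [← intervalIntegral.integral_add_adjacent_intervals
      (intervalIntegrable_abs_sub_rpow_left hr hac) (intervalIntegrable_abs_sub_rpow_right hr hcb),
    intervalIntegral.integral_congr (abs_sub_rpow_eqOn_left r hac),
    intervalIntegral.integral_congr (abs_sub_rpow_eqOn_right r hcb), integral_sub_rpow hr,
    integral_const_sub_rpow hr, sub_self, Real.zero_rpow (by linarith), sub_zero, add_div]

lemma lintegral_abs_sub_rpow (hH : 1 / 2 < H) {w : ℝ} (hw : 0 ≤ w) (hwt : w ≤ t) :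
    ∫⁻ v in Set.Ioc 0 t, ENNReal.ofReal (H * (2 * H - 1) * |w - v| ^ (2 * H - 2)) =
      ENNReal.ofReal (H * (w ^ (2 * H - 1) + (t - w) ^ (2 * H - 1))) := by
  have hr : -1 < 2 * H - 2 := by linarith
  have hint := ((intervalIntegrable_abs_sub_rpow_left hr hw).trans
    (intervalIntegrable_abs_sub_rpow_right hr hwt)).const_mul (H * (2 * H - 1))
  have hH₀ : 0 < 2 * H - 1 := by linarith
  simp only [abs_sub_comm w]
  rw [← ofReal_integral_eq_lintegral_ofReal hint.1
      (ae_of_all _ fun v => mul_nonneg (by nlinarith) (Real.rpow_nonneg (abs_nonneg _) _)),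
    ← intervalIntegral.integral_of_le (hw.trans hwt), intervalIntegral.integral_const_mul,
    integral_abs_sub_rpow hr hw hwt, sub_zero, show 2 * H - 2 + 1 = 2 * H - 1 by ring,
    mul_assoc, mul_div_cancel₀ _ hH₀.ne']

lemma lintegral_rpow_add_sub_rpow (hH : 0 < H) (hs : 0 ≤ s) (hst : s ≤ t) :
    ∫⁻ w in Set.Ioc 0 s, ENNReal.ofReal (H * (w ^ (2 * H - 1) + (t - w) ^ (2 * H - 1))) =
      ENNReal.ofReal ((s ^ (2 * H) + t ^ (2 * H) - (t - s) ^ (2 * H)) / 2) := by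
  have hr : -1 < 2 * H - 1 := by linarith
  have hint₁ : IntervalIntegrable (fun v : ℝ => v ^ (2 * H - 1)) volume 0 s :=
    intervalIntegral.intervalIntegrable_rpow' hr
  have hint₂ := intervalIntegrable_const_sub_rpow hr t 0 s
  rw [← ofReal_integral_eq_lintegral_ofReal ((hint₁.add hint₂).const_mul H).1,
    ← intervalIntegral.integral_of_le hs, intervalIntegral.integral_const_mul,
    intervalIntegral.integral_add hint₁ hint₂, integral_rpow (Or.inl hr),
    integral_const_sub_rpow hr, sub_zero, sub_add_cancel, Real.zero_rpow (by linarith), sub_zero]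
  · congr 1
    field_simp
    ring
  · filter_upwards [ae_restrict_mem measurableSet_Ioc] with w hw
    have := hw.1.le
    have : 0 ≤ t - w := by linarith [hw.2]
    simp only [Pi.zero_apply]
    positivity

lemma lintegral_kernel_mul_kernel_of_le (hH : 1 / 2 < H) (hH' : H < 1) (hs : 0 ≤ s)
    (hst : s ≤ t) :
    ∫⁻ x in Set.Ioi 0, ENNReal.ofReal (kernel H s x) * ENNReal.ofReal (kernel H t x) =
      ENNReal.ofReal ((s ^ (2 * H) + t ^ (2 * H) - (t - s) ^ (2 * H)) / 2) := by
  rw [setLIntegral_kernel_mul_eq_lintegral_kernelDensity hH,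
    ← lintegral_rpow_add_sub_rpow (by linarith) hs hst]
  refine setLIntegral_congr_fun measurableSet_Ioc fun w hw => ?_
  rw [← lintegral_abs_sub_rpow hH hw.1.le (hw.2.trans hst)]
  refine lintegral_congr_ae ?_
  filter_upwards [ae_restrict_mem measurableSet_Ioc, ae_restrict_of_ae (Measure.ae_ne volume w)]
    with v hv hvw
  exact lintegral_kernelDensity_mul hH hH' hw.1 hv.1 hvw.symm

/-- The covariance function of fractional Brownian motion with Hurst parameter `H`. -/
def fbmCov (H s t : ℝ) : ℝ :=
  (s ^ (2 * H) + t ^ (2 * H) - |s - t| ^ (2 * H)) / 2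

lemma fbmCov_comm (H s t : ℝ) : fbmCov H s t = fbmCov H t s := by
  rw [fbmCov, fbmCov, abs_sub_comm, add_comm (s ^ _)]

lemma fbmCov_self (hH : H ≠ 0) (t : ℝ) : fbmCov H t t = t ^ (2 * H) := by
  simp [fbmCov, hH]

lemma fbmCov_nonneg (hH : 0 ≤ H) (hs : 0 ≤ s) (ht : 0 ≤ t) : 0 ≤ fbmCov H s t := by
  wlog hst : s ≤ t
  · exact fbmCov_comm H s t ▸ this hH ht hs (le_of_not_ge hst)
  have h : |s - t| ^ (2 * H) ≤ t ^ (2 * H) :=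
    Real.rpow_le_rpow (abs_nonneg _) (by rw [abs_le]; constructor <;> linarith) (by linarith)
  have := Real.rpow_nonneg hs (2 * H)
  rw [fbmCov]
  linarith

lemma lintegral_kernel_mul_kernel (hH : 1 / 2 < H) (hH' : H < 1) (hs : 0 ≤ s) (ht : 0 ≤ t) :
    ∫⁻ x in Set.Ioi 0, ENNReal.ofReal (kernel H s x * kernel H t x) =
      ENNReal.ofReal (fbmCov H s t) := by
  wlog hst : s ≤ t
  · simpa only [mul_comm, fbmCov_comm] using this hH hH' ht hs (le_of_not_ge hst)
  rw [setLIntegral_congr_fun measurableSet_Ioi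
      fun x hx => ENNReal.ofReal_mul (kernel_nonneg hH hx s),
    lintegral_kernel_mul_kernel_of_le hH hH' hs hst, fbmCov, abs_sub_comm,
    abs_of_nonneg (sub_nonneg.2 hst)]

lemma ae_kernel_mul_kernel_nonneg (hH : 1 / 2 < H) (s t : ℝ) :
    0 ≤ᵐ[volume.restrict (Set.Ioi 0)] fun x => kernel H s x * kernel H t x := by
  filter_upwards [ae_restrict_mem measurableSet_Ioi] with x hx
  exact mul_nonneg (kernel_nonneg hH hx s) (kernel_nonneg hH hx t)

lemma memLp_two_kernel (hH : 1 / 2 < H) (hH' : H < 1) (ht : 0 ≤ t) :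
    MemLp (kernel H t) 2 (volume.restrict (Set.Ioi 0)) := by
  have hm := aestronglyMeasurable_kernel H t
  rw [memLp_two_iff_integrable_sq hm]
  simp only [sq]
  refine ⟨hm.mul hm, ?_⟩
  rw [hasFiniteIntegral_iff_ofReal (ae_kernel_mul_kernel_nonneg hH t t),
    lintegral_kernel_mul_kernel hH hH' ht ht]
  exact ENNReal.ofReal_lt_top

lemma integral_kernel_mul_kernel (hH : 1 / 2 < H) (hH' : H < 1) (hs : 0 ≤ s) (ht : 0 ≤ t) :
    ∫ x in Set.Ioi 0, kernel H s x * kernel H t x = fbmCov H s t := by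
  rw [integral_eq_lintegral_of_nonneg_ae (ae_kernel_mul_kernel_nonneg hH s t)
      ((aestronglyMeasurable_kernel H s).mul (aestronglyMeasurable_kernel H t)),
    lintegral_kernel_mul_kernel hH hH' hs ht,
    ENNReal.toReal_ofReal (fbmCov_nonneg (by linarith) hs ht)]

end KernelCovariance

section OrthonormalApproximation

open scoped InnerProductSpace

variable {E ι : Type*} [NormedAddCommGroup E] [InnerProductSpace ℝ E] [Fintype ι] {e : ι → E}

lemma sum_inner_mul_inner_of_mem_span (he : Orthonormal ℝ e) {u : E}
    (hu : u ∈ Submodule.span ℝ (Set.range e)) (y : E) :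
    ∑ i, ⟪e i, u⟫_ℝ * ⟪e i, y⟫_ℝ = ⟪u, y⟫_ℝ := by
  induction hu using Submodule.span_induction with
  | mem w hw =>
    obtain ⟨j, rfl⟩ := hw
    classical
    simp [orthonormal_iff_ite.1 he]
  | zero => simp
  | add u v _ _ hu hv => simp only [inner_add_left, inner_add_right, add_mul,
      Finset.sum_add_distrib, hu, hv]
  | smul a u _ hu => simp only [real_inner_smul_left, real_inner_smul_right, mul_assoc,
      ← Finset.mul_sum, hu]

lemma sum_inner_sq_le (he : Orthonormal ℝ e) (x : E) : ∑ i, ⟪e i, x⟫_ℝ ^ 2 ≤ ‖x‖ ^ 2 := by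
  simpa using he.sum_inner_products_le x (s := Finset.univ)

lemma abs_sum_inner_mul_inner_le (he : Orthonormal ℝ e) (x y : E) :
    |∑ i, ⟪e i, x⟫_ℝ * ⟪e i, y⟫_ℝ| ≤ ‖x‖ * ‖y‖ := by
  refine abs_le_of_sq_le_sq ?_ (by positivity)
  calc (∑ i, ⟪e i, x⟫_ℝ * ⟪e i, y⟫_ℝ) ^ 2
      ≤ (∑ i, ⟪e i, x⟫_ℝ ^ 2) * ∑ i, ⟪e i, y⟫_ℝ ^ 2 := Finset.sum_mul_sq_le_sq_mul_sq _ _ _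
    _ ≤ ‖x‖ ^ 2 * ‖y‖ ^ 2 := by gcongr <;> exact sum_inner_sq_le he _
    _ = (‖x‖ * ‖y‖) ^ 2 := (mul_pow _ _ _).symm

lemma abs_sum_inner_mul_inner_sub_inner_le (he : Orthonormal ℝ e) (x y : E) :
    |∑ i, ⟪e i, x⟫_ℝ * ⟪e i, y⟫_ℝ - ⟪x, y⟫_ℝ| ≤
      2 * ‖y‖ * Metric.infDist x (Submodule.span ℝ (Set.range e)) := by
  rw [Metric.infDist_eq_iInf, Real.mul_iInf_of_nonneg (by positivity)]
  refine le_ciInf fun ⟨u, hu⟩ => ?_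
  calc |∑ i, ⟪e i, x⟫_ℝ * ⟪e i, y⟫_ℝ - ⟪x, y⟫_ℝ|
      = |∑ i, ⟪e i, x - u⟫_ℝ * ⟪e i, y⟫_ℝ - ⟪x - u, y⟫_ℝ| := by
        simp only [inner_sub_left, inner_sub_right, sub_mul, Finset.sum_sub_distrib,
          sum_inner_mul_inner_of_mem_span he hu, sub_sub_sub_cancel_right]
    _ ≤ ‖x - u‖ * ‖y‖ + ‖x - u‖ * ‖y‖ := (abs_sub _ _).trans
        (add_le_add (abs_sum_inner_mul_inner_le he _ _) (abs_real_inner_le_norm _ _))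
    _ = 2 * ‖y‖ * dist x u := by
        rw [dist_eq_norm]
        ring

lemma tendsto_sum_inner_mul_inner {κ : ℕ → Type*} [∀ n, Fintype (κ n)] {e : ∀ n, κ n → E}
    (he : ∀ n, Orthonormal ℝ (e n)) {x y : E} {x' y' : ℕ → E}
    (hdist : Tendsto (fun n => Metric.infDist x (Submodule.span ℝ (Set.range (e n)))) atTop (𝓝 0))
    (hx : Tendsto x' atTop (𝓝 x)) (hy : Tendsto y' atTop (𝓝 y)) :
    Tendsto (fun n => ∑ i, ⟪e n i, x' n⟫_ℝ * ⟪e n i, y' n⟫_ℝ) atTop (𝓝 ⟪x, y⟫_ℝ) := by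
  have hbound : Tendsto (fun n => 2 * ‖y' n‖ *
      (Metric.infDist x (Submodule.span ℝ (Set.range (e n))) + dist (x' n) x)) atTop (𝓝 0) := by
    simpa using (hy.norm.const_mul 2).mul (hdist.add (tendsto_iff_dist_tendsto_zero.1 hx))
  refine (tendsto_iff_of_dist (squeeze_zero (fun _ => dist_nonneg) (fun n => ?_) hbound)).1
    (hx.inner hy)
  rw [dist_comm, Real.dist_eq]
  refine (abs_sum_inner_mul_inner_sub_inner_le (he n) _ _).trans ?_
  gcongr
  exact Metric.infDist_le_infDist_add_dist

end OrthonormalApproximation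

section Grid

/-- The cell `(i / n, (i + 1) / n]` of the regular partition of `(0, 1]` into `n` intervals. -/
def cell (n i : ℕ) : Set ℝ := Set.Ioc ((i : ℝ) / n) (((i : ℝ) + 1) / n)

variable {n : ℕ}

lemma cell_le_cell (n i : ℕ) : (i : ℝ) / n ≤ ((i : ℝ) + 1) / n := by
  gcongr
  linarith

lemma measurableSet_cell (n i : ℕ) : MeasurableSet (cell n i) := measurableSet_Ioc

lemma cell_subset {i : ℕ} (hi : i < n) : cell n i ⊆ Set.Ioc 0 1 := by
  refine Set.Ioc_subset_Ioc (by positivity) (div_le_one_of_le₀ ?_ (Nat.cast_nonneg n))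
  exact_mod_cast hi

lemma pairwise_disjoint_cell (n : ℕ) : Pairwise (Function.onFun Disjoint (cell n)) := by
  have hmono : Monotone fun k : ℕ => (k : ℝ) / n := fun a b hab => by
    simp only
    gcongr
  unfold cell
  simpa using hmono.pairwise_disjoint_on_Ioc_succ

lemma exists_mem_cell (hn : n ≠ 0) {x : ℝ} (hx : x ∈ Set.Ioc (0 : ℝ) 1) :
    ∃ i : Fin n, x ∈ cell n i := by
  have hn₀ : (0 : ℝ) < n := by positivity
  have hpos : 0 < (n : ℝ) * x := mul_pos hn₀ hx.1
  obtain ⟨k, hk⟩ := Nat.exists_eq_add_one_of_ne_zero (Nat.ceil_pos.2 hpos).ne'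
  have hkn : k + 1 ≤ n := hk ▸ Nat.ceil_le.2 (mul_le_of_le_one_right hn₀.le hx.2)
  have hlt := Nat.ceil_lt_add_one hpos.le
  have hle := Nat.le_ceil ((n : ℝ) * x)
  rw [hk] at hlt hle
  push_cast at hlt hle
  refine ⟨⟨k, hkn⟩, ?_, ?_⟩
  · rw [div_lt_iff₀ hn₀]
    linarith
  · rw [le_div_iff₀ hn₀]
    linarith

lemma measureReal_cell {i : ℕ} (hi : i < n) :
    (volume.restrict (Set.Ioc (0 : ℝ) 1)).real (cell n i) = (n : ℝ)⁻¹ := by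
  rw [measureReal_restrict_apply (measurableSet_cell n i),
    Set.inter_eq_self_of_subset_left (cell_subset hi), cell,
    Real.volume_real_Ioc_of_le (cell_le_cell n i)]
  ring

/-- The square-integrable function `√n 1_{(i / n, (i + 1) / n]}` on `(0, 1]`. -/
def cellVec (n i : ℕ) : Lp ℝ 2 (volume.restrict (Set.Ioc (0 : ℝ) 1)) :=
  indicatorConstLp 2 (measurableSet_cell n i) (measure_ne_top _ _) (√n)

lemma orthonormal_cellVec (n : ℕ) : Orthonormal ℝ fun i : Fin n => cellVec n i := by
  rw [orthonormal_iff_ite]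
  intro i j
  rw [cellVec, cellVec, L2.inner_indicatorConstLp_indicatorConstLp (measurableSet_cell n i)
    (measurableSet_cell n j) (measure_ne_top _ _) (measure_ne_top _ _)]
  split_ifs with hij
  · have hn : (n : ℝ) ≠ 0 := by
      have := i.pos
      positivity
    rw [hij, Set.inter_self, measureReal_cell j.2]
    simp [hn]
  · have hdisj := (pairwise_disjoint_cell n).comp_of_injective Fin.val_injective hij
    rw [Set.disjoint_iff_inter_eq_empty.1 hdisj]
    simp

lemma inner_cellVec_toLp {f : ℝ → ℝ} (hf : MemLp f 2 (volume.restrict (Set.Ioc 0 1))) {i : ℕ}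
    (hi : i < n) : inner ℝ (cellVec n i) (hf.toLp f) = √n * ∫ x in cell n i, f x := by
  rw [cellVec, L2.inner_indicatorConstLp_eq_inner_setIntegral ℝ (measurableSet_cell n i),
    Measure.restrict_restrict (measurableSet_cell n i),
    Set.inter_eq_self_of_subset_left (cell_subset hi),
    integral_congr_ae (ae_mono (Measure.restrict_mono (cell_subset hi) le_rfl) hf.coeFn_toLp)]
  simp [mul_comm]

lemma ae_mem_cell_sum_smul_cellVec (hn : n ≠ 0) (a : ℕ → ℝ) :
    ∀ᵐ x ∂(volume.restrict (Set.Ioc (0 : ℝ) 1)), ∀ i < n, x ∈ cell n i →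
      (∑ j : Fin n, (a j / √n) • cellVec n j :
        Lp ℝ 2 (volume.restrict (Set.Ioc (0 : ℝ) 1))) x = a i := by
  have hcoe (j : Fin n) : ((a j / √n) • cellVec n j :
      Lp ℝ 2 (volume.restrict (Set.Ioc (0 : ℝ) 1))) =ᵐ[volume.restrict (Set.Ioc (0 : ℝ) 1)]
      (cell n j).indicator fun _ => a j := by
    filter_upwards [Lp.coeFn_smul (a j / √n) (cellVec n j), indicatorConstLp_coeFn
      (hs := measurableSet_cell n j) (hμs := measure_ne_top _ _) (c := √n)] with x hsmul hind
    rw [hsmul, Pi.smul_apply, cellVec, hind, smul_eq_mul, ← Set.indicator_const_mul]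
    simp [hn]
  filter_upwards [Lp.coeFn_fun_finsetSum Finset.univ fun j : Fin n => (a j / √n) • cellVec n j,
    eventually_all.2 hcoe] with x hsum hx i hi hxi
  rw [hsum, Finset.sum_congr rfl fun j _ => hx j,
    Finset.sum_eq_single_of_mem ⟨i, hi⟩ (Finset.mem_univ _), Set.indicator_of_mem hxi]
  intro j _ hji
  refine Set.indicator_of_notMem (fun hxj => ?_) _
  exact (Set.disjoint_left.1 (pairwise_disjoint_cell n (Fin.val_ne_of_ne hji)) hxj) hxi

lemma exists_mem_span_cellVec_norm_sub_le {g : ℝ → ℝ} (hg : UniformContinuous g)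
    (hg₂ : MemLp g 2 (volume.restrict (Set.Ioc (0 : ℝ) 1))) {ε : ℝ} (hε : 0 < ε) :
    ∀ᶠ n : ℕ in atTop, ∃ u ∈ Submodule.span ℝ (Set.range fun i : Fin n => cellVec n i),
      ‖hg₂.toLp g - u‖ ≤ ε := by
  obtain ⟨δ, hδ, hgδ⟩ := Metric.uniformContinuous_iff.1 hg ε hε
  filter_upwards [(tendsto_one_div_atTop_nhds_zero_nat (𝕜 := ℝ)).eventually_lt_const hδ,
    eventually_ne_atTop 0] with n hnδ hn
  let u : Lp ℝ 2 (volume.restrict (Set.Ioc (0 : ℝ) 1)) :=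
    ∑ j : Fin n, (g ((j : ℕ) / n) / √n) • cellVec n j
  refine ⟨u, Submodule.sum_mem _ fun j _ => Submodule.smul_mem _ _
    (Submodule.subset_span ⟨j, rfl⟩), ?_⟩
  have hle : ∀ᵐ x ∂(volume.restrict (Set.Ioc (0 : ℝ) 1)), ‖(hg₂.toLp g - u) x‖ ≤ ε := by
    filter_upwards [ae_restrict_mem measurableSet_Ioc, Lp.coeFn_sub (hg₂.toLp g) u,
      hg₂.coeFn_toLp, ae_mem_cell_sum_smul_cellVec hn fun j => g (j / n)] with x hx hsub hgx hux
    obtain ⟨i, hi⟩ := exists_mem_cell hn hx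
    rw [hsub, Pi.sub_apply, hgx, hux i i.2 hi, ← dist_eq_norm]
    refine (hgδ ?_).le
    rw [Real.dist_eq, abs_of_nonneg (sub_nonneg.2 hi.1.le)]
    have := hi.2
    rw [add_div] at this
    linarith
  simpa [measureUnivNNReal] using Lp.norm_le_of_ae_bound hε.le hle

lemma tendsto_infDist_span_cellVec (f : Lp ℝ 2 (volume.restrict (Set.Ioc (0 : ℝ) 1))) :
    Tendsto (fun n : ℕ =>
      Metric.infDist f (Submodule.span ℝ (Set.range fun i : Fin n => cellVec n i)))
      atTop (𝓝 0) := by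
  refine tendsto_order.2 ⟨fun a ha => .of_forall fun n => ha.trans_le Metric.infDist_nonneg,
    fun ε hε => ?_⟩
  obtain ⟨g, hgc, hfg, hg, hg₂⟩ := (Lp.memLp f).exists_hasCompactSupport_eLpNorm_sub_le
    ENNReal.ofNat_ne_top (ENNReal.ofReal_pos.2 (show 0 < ε / 3 by positivity)).ne'
  have hfg' : dist f (hg₂.toLp g) ≤ ε / 3 := by
    rw [← Lp.toLp_coeFn f (Lp.memLp f), dist_edist, Lp.edist_toLp_toLp]
    exact ENNReal.toReal_le_of_le_ofReal (by positivity) hfg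
  filter_upwards [exists_mem_span_cellVec_norm_sub_le
    (hgc.uniformContinuous_of_continuous hg) hg₂ (show 0 < ε / 3 by positivity)]
    with n ⟨u, hu, hgu⟩
  rw [← dist_eq_norm] at hgu
  calc _ ≤ dist f u := Metric.infDist_le_dist_of_mem hu
    _ ≤ dist f (hg₂.toLp g) + dist (hg₂.toLp g) u := dist_triangle _ _ _
    _ < ε := by linarith

end Grid

section GridCoefficients

/-- The largest multiple of `1 / n` that does not exceed `t` (and `0` if `n = 0`). -/
def gridFloor (n : ℕ) (t : unitInterval) : unitInterval :=
  ⟨(⌊(n : ℝ) * t⌋₊ : ℝ) / n, by positivity, div_le_one_of_le₀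
    ((Nat.floor_le (mul_nonneg n.cast_nonneg t.2.1)).trans
      (mul_le_of_le_one_right n.cast_nonneg t.2.2))
    (Nat.cast_nonneg n)⟩

variable {n : ℕ} {s t : unitInterval}

lemma coe_gridFloor (n : ℕ) (t : unitInterval) :
    (gridFloor n t : ℝ) = (⌊(n : ℝ) * t⌋₊ : ℝ) / n := rfl

lemma gridFloor_le (n : ℕ) (t : unitInterval) : gridFloor n t ≤ t := by
  refine Subtype.coe_le_coe.1 (div_le_of_le_mul₀ (Nat.cast_nonneg n) t.2.1 ?_)
  exact (Nat.floor_le (mul_nonneg n.cast_nonneg t.2.1)).trans_eq (mul_comm _ _)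

lemma gridFloor_mono (n : ℕ) : Monotone (gridFloor n) := fun s t hst => by
  rw [← Subtype.coe_le_coe] at hst ⊢
  simp only [coe_gridFloor]
  gcongr

lemma tendsto_gridFloor (t : unitInterval) : Tendsto (gridFloor · t) atTop (𝓝 t) := by
  rw [tendsto_subtype_rng]
  simpa only [coe_gridFloor, mul_comm, Function.comp_def] using
    (tendsto_nat_floor_mul_div_atTop t.2.1).comp tendsto_natCast_atTop_atTop

variable {H : ℝ}

lemma memLp_two_kernel_Ioc (hH : 1 / 2 < H) (hH' : H < 1) (t : unitInterval) :
    MemLp (kernel H t) 2 (volume.restrict (Set.Ioc 0 1)) :=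
  (memLp_two_kernel hH hH' t.2.1).mono_measure
    (Measure.restrict_mono Set.Ioc_subset_Ioi_self le_rfl)

/-- The kernel `z(t, ·)` as an element of `L²(0, 1)`. -/
def kernelL2 (hH : 1 / 2 < H) (hH' : H < 1) (t : unitInterval) :
    Lp ℝ 2 (volume.restrict (Set.Ioc (0 : ℝ) 1)) :=
  (memLp_two_kernel_Ioc hH hH' t).toLp (kernel H t)

lemma inner_kernelL2 (hH : 1 / 2 < H) (hH' : H < 1) (s t : unitInterval) :
    inner ℝ (kernelL2 hH hH' s) (kernelL2 hH hH' t) = fbmCov H s t := by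
  have hsupp : ∀ x ∈ Set.Ioi (0 : ℝ) \ Set.Ioc 0 1, kernel H s x * kernel H t x = 0 :=
    fun x hx => by
      have hx₁ : 1 < x := lt_of_not_ge fun h => hx.2 ⟨hx.1, h⟩
      rw [kernel_of_lt (s.2.2.trans_lt hx₁), zero_mul]
  rw [← integral_kernel_mul_kernel hH hH' s.2.1 t.2.1,
    setIntegral_eq_of_subset_of_forall_sdiff_eq_zero measurableSet_Ioi Set.Ioc_subset_Ioi_self
      hsupp, L2.inner_def]
  refine integral_congr_ae ?_
  filter_upwards [(memLp_two_kernel_Ioc hH hH' s).coeFn_toLp,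
    (memLp_two_kernel_Ioc hH hH' t).coeFn_toLp] with x hs ht
  rw [kernelL2, kernelL2, hs, ht, real_inner_eq_re_inner, RCLike.inner_apply]
  simp [mul_comm]

lemma norm_kernelL2_sq (hH : 1 / 2 < H) (hH' : H < 1) (t : unitInterval) :
    ‖kernelL2 hH hH' t‖ ^ 2 = (t : ℝ) ^ (2 * H) := by
  rw [← real_inner_self_eq_norm_sq, inner_kernelL2, fbmCov_self (by linarith)]

lemma norm_kernelL2_sub_sq (hH : 1 / 2 < H) (hH' : H < 1) (s t : unitInterval) :
    ‖kernelL2 hH hH' s - kernelL2 hH hH' t‖ ^ 2 = |(s : ℝ) - t| ^ (2 * H) := by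
  rw [norm_sub_sq_real, inner_kernelL2, norm_kernelL2_sq, norm_kernelL2_sq, fbmCov]
  ring

lemma continuous_kernelL2 (hH : 1 / 2 < H) (hH' : H < 1) : Continuous (kernelL2 hH hH') := by
  refine continuous_iff_continuousAt.2 fun t => tendsto_iff_norm_sub_tendsto_zero.2 ?_
  have hcont : Continuous fun s : unitInterval => √(|(s : ℝ) - t| ^ (2 * H)) := by
    have : 0 ≤ 2 * H := by linarith
    fun_prop (disch := assumption)
  have hlim := hcont.tendsto t
  rw [sub_self, abs_zero, Real.zero_rpow (by linarith), Real.sqrt_zero] at hlim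
  refine hlim.congr fun s => ?_
  rw [← norm_kernelL2_sub_sq hH hH', Real.sqrt_sq (norm_nonneg _)]

lemma bCoeff_eq_setIntegral (H : ℝ) (t : unitInterval) (i : Fin n) :
    bCoeff H n t i = √n * ∫ x in cell n i, kernel H (gridFloor n t) x := by
  rw [bCoeff, intervalIntegral.integral_of_le (cell_le_cell n i), coe_gridFloor, cell]

lemma inner_cellVec_kernelL2 (hH : 1 / 2 < H) (hH' : H < 1) (t : unitInterval) (i : Fin n) :
    inner ℝ (cellVec n i) (kernelL2 hH hH' (gridFloor n t)) = bCoeff H n t i := by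
  rw [bCoeff_eq_setIntegral, kernelL2, inner_cellVec_toLp _ i.2]

lemma sum_bCoeff_sq_le (hH : 1 / 2 < H) (hH' : H < 1) (n : ℕ) (t : unitInterval) :
    ∑ i, bCoeff H n t i ^ 2 ≤ (t : ℝ) ^ (2 * H) := by
  calc ∑ i, bCoeff H n t i ^ 2
      = ∑ i : Fin n, inner ℝ (cellVec n i) (kernelL2 hH hH' (gridFloor n t)) ^ 2 := by
        simp only [inner_cellVec_kernelL2]
    _ ≤ ‖kernelL2 hH hH' (gridFloor n t)‖ ^ 2 := sum_inner_sq_le (orthonormal_cellVec n) _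
    _ = (gridFloor n t : ℝ) ^ (2 * H) := norm_kernelL2_sq hH hH' _
    _ ≤ (t : ℝ) ^ (2 * H) :=
        Real.rpow_le_rpow (gridFloor n t).2.1 (gridFloor_le n t) (by linarith)

lemma tendsto_sum_bCoeff_mul_bCoeff (hH : 1 / 2 < H) (hH' : H < 1) (s t : unitInterval) :
    Tendsto (fun n : ℕ => ∑ i, bCoeff H n s i * bCoeff H n t i) atTop (𝓝 (fbmCov H s t)) := by
  have hlim (r : unitInterval) :
      Tendsto (fun n => kernelL2 hH hH' (gridFloor n r)) atTop (𝓝 (kernelL2 hH hH' r)) :=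
    ((continuous_kernelL2 hH hH').tendsto r).comp (tendsto_gridFloor r)
  simpa only [inner_cellVec_kernelL2, inner_kernelL2] using tendsto_sum_inner_mul_inner
    orthonormal_cellVec (tendsto_infDist_span_cellVec (kernelL2 hH hH' s)) (hlim s) (hlim t)

lemma integrableOn_kernel_cell (hH : 1 / 2 < H) (hH' : H < 1) (t : unitInterval) {i : ℕ}
    (hi : i < n) : IntegrableOn (kernel H t) (cell n i) :=
  IntegrableOn.mono_set ((memLp_two_kernel_Ioc hH hH' t).integrable one_le_two) (cell_subset hi)

lemma bCoeff_nonneg (hH : 1 / 2 < H) (n : ℕ) (t : unitInterval) (i : Fin n) :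
    0 ≤ bCoeff H n t i := by
  rw [bCoeff_eq_setIntegral]
  exact mul_nonneg (Real.sqrt_nonneg _) (setIntegral_nonneg (measurableSet_cell n i)
    fun x hx => kernel_nonneg hH (cell_subset i.2 hx).1 _)

lemma bCoeff_mono (hH : 1 / 2 < H) (hH' : H < 1) (hst : s ≤ t) (i : Fin n) :
    bCoeff H n s i ≤ bCoeff H n t i := by
  rw [bCoeff_eq_setIntegral, bCoeff_eq_setIntegral]
  refine mul_le_mul_of_nonneg_left ?_ (Real.sqrt_nonneg _)
  exact setIntegral_mono_on (integrableOn_kernel_cell hH hH' _ i.2)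
    (integrableOn_kernel_cell hH hH' _ i.2) (measurableSet_cell n i)
    fun x hx => kernel_mono hH (cell_subset i.2 hx).1 (gridFloor_mono n hst)

lemma bCoeff_eq_zero {i : Fin n} (hi : ⌊(n : ℝ) * t⌋₊ ≤ i) : bCoeff H n t i = 0 := by
  have hzero : ∀ x ∈ cell n i, kernel H (gridFloor n t) x = 0 := fun x hx => by
    refine kernel_of_lt (lt_of_le_of_lt ?_ hx.1)
    rw [coe_gridFloor]
    gcongr
  rw [bCoeff_eq_setIntegral, setIntegral_congr_fun (measurableSet_cell n i) hzero]
  simp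

lemma setIntegral_cell_rpow_le {r : ℝ} (hr : -(1 / 2) < r) (hr₀ : r ≤ 0) (n i : ℕ) :
    ∫ x in cell n i, x ^ r ≤ 2 * (n : ℝ)⁻¹ ^ (r + 1) := by
  have hsub : (((i : ℝ) + 1) / n) ^ (r + 1) - ((i : ℝ) / n) ^ (r + 1) ≤ (n : ℝ)⁻¹ ^ (r + 1) := by
    rw [sub_le_iff_le_add', add_div, one_div]
    exact Real.rpow_add_le_add_rpow (by positivity) (by positivity) (by linarith) (by linarith)
  rw [cell, ← intervalIntegral.integral_of_le (cell_le_cell n i),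
    integral_rpow (.inl (by linarith)), div_le_iff₀ (by linarith)]
  have : 0 ≤ (n : ℝ)⁻¹ ^ (r + 1) := by positivity
  nlinarith

lemma bCoeff_sq_le (hH : 1 / 2 < H) (hH' : H < 1) (t : unitInterval) (i : Fin n) :
    bCoeff H n t i ^ 2 ≤ 4 * cH H ^ 2 * (n : ℝ) ^ (-(2 - 2 * H)) := by
  have hn : (0 : ℝ) < n := by exact_mod_cast i.pos
  have hc := cH_nonneg H
  have hint : ∫ x in cell n i, kernel H (gridFloor n t) x ≤
      cH H * (2 * (n : ℝ)⁻¹ ^ (3 / 2 - H)) := by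
    calc ∫ x in cell n i, kernel H (gridFloor n t) x
        ≤ ∫ x in cell n i, cH H * x ^ (1 / 2 - H) := by
          refine setIntegral_mono_on (integrableOn_kernel_cell hH hH' _ i.2) ?_
            (measurableSet_cell n i)
            fun x hx => kernel_le hH (cell_subset i.2 hx).1 (gridFloor n t).2.2
          exact (intervalIntegral.intervalIntegrable_rpow' (by linarith)).1.const_mul _
      _ ≤ cH H * (2 * (n : ℝ)⁻¹ ^ (3 / 2 - H)) := by
          rw [integral_const_mul, show 3 / 2 - H = 1 / 2 - H + 1 by ring]
          gcongr
          exact setIntegral_cell_rpow_le (by linarith) (by linarith) n i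
  have h₀ : 0 ≤ ∫ x in cell n i, kernel H (gridFloor n t) x :=
    setIntegral_nonneg (measurableSet_cell n i)
      fun x hx => kernel_nonneg hH (cell_subset i.2 hx).1 _
  calc bCoeff H n t i ^ 2 = n * (∫ x in cell n i, kernel H (gridFloor n t) x) ^ 2 := by
        rw [bCoeff_eq_setIntegral, mul_pow, Real.sq_sqrt hn.le]
    _ ≤ n * (cH H * (2 * (n : ℝ)⁻¹ ^ (3 / 2 - H))) ^ 2 := by gcongr
    _ = 4 * cH H ^ 2 * (n : ℝ) ^ (-(2 - 2 * H)) := by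
        have hpow : (n : ℝ) ^ (-(2 - 2 * H)) = n * ((n : ℝ)⁻¹ ^ (3 / 2 - H)) ^ 2 := by
          rw [Real.inv_rpow hn.le, ← Real.rpow_neg hn.le, ← Real.rpow_mul_natCast hn.le,
            ← Real.rpow_one_add' hn.le (by push_cast; linarith)]
          congr 1
          push_cast
          ring
        rw [hpow]
        ring

end GridCoefficients

section DisturbedWalk

lemma disturbedWalk_eq_sum {Ω : Type*} (H : ℝ) {n : ℕ} (x : Fin n → Ω → ℝ) (t : unitInterval) :
    disturbedWalk H x t = fun ω => ∑ i, bCoeff H n t i * x i ω := by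
  funext ω
  refine Finset.sum_subset (Finset.filter_subset _ _) fun i _ hi => ?_
  rw [bCoeff_eq_zero (by simpa using hi), zero_mul]

variable {Ω : Type*} [MeasurableSpace Ω] {P : Measure Ω} {H : ℝ} {n : ℕ} {x : Fin n → Ω → ℝ}
  {s t : unitInterval}

lemma IsStandardIndep.integral_disturbedWalk_mul (hx : IsStandardIndep P x) (H : ℝ)
    (s t : unitInterval) :
    ∫ ω, disturbedWalk H x s ω * disturbedWalk H x t ω ∂P =
      ∑ i, bCoeff H n s i * bCoeff H n t i := by
  simpa only [disturbedWalk_eq_sum] using hx.integral_sum_mul_sum _ _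

lemma IsStandardIndep.integral_disturbedWalk_sq (hx : IsStandardIndep P x) (H : ℝ)
    (t : unitInterval) :
    ∫ ω, disturbedWalk H x t ω ^ 2 ∂P = ∑ i, bCoeff H n t i ^ 2 := by
  simpa only [sq] using hx.integral_disturbedWalk_mul H t t

lemma IsStandardIndep.integral_discreteWickPow_disturbedWalk_sub_sq (hx : IsStandardIndep P x)
    (H : ℝ) (N : ℕ) (s t : unitInterval) :
    ∫ ω, (discreteWickPow P x (disturbedWalk H x t) N ω
        - discreteWickPow P x (disturbedWalk H x s) N ω) ^ 2 ∂P =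
      N.factorial * ∑ g : Fin N → Fin n with Function.Injective g,
        (∏ j, bCoeff H n t (g j) - ∏ j, bCoeff H n s (g j)) ^ 2 := by
  rw [disturbedWalk_eq_sum, disturbedWalk_eq_sum, hx.integral_discreteWickPow_sub_sq,
    sum_wickPowCoeff_sub_sq]

theorem IsStandardIndep.wickPow_defect_mem_Icc (hx : IsStandardIndep P x) (hH : 1 / 2 < H)
    (hH' : H < 1) (N : ℕ) (hst : s ≤ t) :
    (∫ ω, disturbedWalk H x t ω ^ 2 ∂P) ^ N + (∫ ω, disturbedWalk H x s ω ^ 2 ∂P) ^ N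
        - 2 * (∫ ω, disturbedWalk H x t ω * disturbedWalk H x s ω ∂P) ^ N
        - 1 / (N.factorial : ℝ) * ∫ ω, (discreteWickPow P x (disturbedWalk H x t) N ω
            - discreteWickPow P x (disturbedWalk H x s) N ω) ^ 2 ∂P
      ∈ Set.Icc 0 (2 * cH H ^ 2 * (N : ℝ) ^ 2 * (t : ℝ) ^ (2 * H * ((N : ℝ) - 1)) *
          (n : ℝ) ^ (-(2 - 2 * H))) := by
  cases N with
  | zero => norm_num [discreteWickPow]
  | succ N =>
    rw [hx.integral_disturbedWalk_sq, hx.integral_disturbedWalk_sq, hx.integral_disturbedWalk_mul,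
      hx.integral_discreteWickPow_disturbedWalk_sub_sq, ← mul_assoc,
      one_div_mul_cancel (by positivity), one_mul]
    refine Set.Icc_subset_Icc_right ?_ (pow_sum_sub_sum_injective_mem_Icc (bCoeff_nonneg hH n s)
      (bCoeff_mono hH hH' hst) (bCoeff_sq_le hH hH' t) N)
    have hpow : (t : ℝ) ^ (2 * H * ((N + 1 : ℕ) - 1)) = ((t : ℝ) ^ (2 * H)) ^ N := by
      rw [Real.rpow_mul t.2.1, Nat.cast_succ, add_sub_cancel_right, Real.rpow_natCast]
    have : 0 ≤ (n : ℝ) ^ (-(2 - 2 * H)) := Real.rpow_nonneg n.cast_nonneg _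
    rw [hpow, Nat.cast_succ]
    calc ((N : ℝ) + 1) * N / 2 * (4 * cH H ^ 2 * (n : ℝ) ^ (-(2 - 2 * H)))
          * (∑ i, bCoeff H n t i ^ 2) ^ N
        ≤ ((N : ℝ) + 1) * (N + 1) / 2 * (4 * cH H ^ 2 * (n : ℝ) ^ (-(2 - 2 * H)))
          * ((t : ℝ) ^ (2 * H)) ^ N := by
          gcongr
          · exact le_add_of_nonneg_right zero_le_one
          · exact sum_bCoeff_sq_le hH hH' n t
      _ = _ := by ring

variable {ξ : (n : ℕ) → Fin n → Ω → ℝ}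

lemma tendsto_integral_disturbedWalk_mul (hξ : ∀ n, IsStandardIndep P (ξ n)) (hH : 1 / 2 < H)
    (hH' : H < 1) (s t : unitInterval) :
    Tendsto (fun n => ∫ ω, disturbedWalk H (ξ n) s ω * disturbedWalk H (ξ n) t ω ∂P) atTop
      (𝓝 (fbmCov H s t)) := by
  simpa only [(hξ _).integral_disturbedWalk_mul] using tendsto_sum_bCoeff_mul_bCoeff hH hH' s t

theorem tendsto_integral_discreteWickPow_sub_sq (hξ : ∀ n, IsStandardIndep P (ξ n))
    (hH : 1 / 2 < H) (hH' : H < 1) (N : ℕ) (s t : unitInterval) :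
    Tendsto (fun n => ∫ ω, (discreteWickPow P (ξ n) (disturbedWalk H (ξ n) t) N ω
        - discreteWickPow P (ξ n) (disturbedWalk H (ξ n) s) N ω) ^ 2 ∂P) atTop
      (𝓝 (N.factorial * (fbmCov H t t ^ N + fbmCov H s s ^ N - 2 * fbmCov H t s ^ N))) := by
  wlog hst : s ≤ t
  · have := this hξ hH hH' N t s (le_of_not_ge hst)
    rw [add_comm, fbmCov_comm H t s]
    refine this.congr fun n => integral_congr_ae (.of_forall fun ω => ?_)
    exact sub_sq_comm _ _
  have hcov (r u : unitInterval) := (tendsto_integral_disturbedWalk_mul hξ hH hH' r u).pow N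
  have hbound : Tendsto (fun n : ℕ => 2 * cH H ^ 2 * (N : ℝ) ^ 2 *
      (t : ℝ) ^ (2 * H * ((N : ℝ) - 1)) * (n : ℝ) ^ (-(2 - 2 * H))) atTop (𝓝 0) := by
    simpa using ((tendsto_rpow_neg_atTop (y := 2 - 2 * H) (by linarith)).comp
      tendsto_natCast_atTop_atTop).const_mul
        (2 * cH H ^ 2 * (N : ℝ) ^ 2 * (t : ℝ) ^ (2 * H * ((N : ℝ) - 1)))
  have hdefect := squeeze_zero (fun n => ((hξ n).wickPow_defect_mem_Icc hH hH' N hst).1)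
    (fun n => ((hξ n).wickPow_defect_mem_Icc hH hH' N hst).2) hbound
  have hlim := ((((hcov t t).add (hcov s s)).sub ((hcov t s).const_mul 2)).sub hdefect).const_mul
    (N.factorial : ℝ)
  rw [sub_zero] at hlim
  refine hlim.congr fun n => ?_
  simp only [← sq]
  field_simp
  ring

end DisturbedWalk

section Hermite

lemma hasDerivAt_gaussianPDFReal (m : ℝ) (v : NNReal) (x : ℝ) :
    HasDerivAt (gaussianPDFReal m v) (-((x - m) / v) * gaussianPDFReal m v x) x := by
  rw [gaussianPDFReal_def]
  have hexponent : HasDerivAt (fun x => -(x - m) ^ 2 / (2 * v)) (-((x - m) / v)) x := by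
    refine ((((hasDerivAt_id x).sub_const m).pow 2).neg.div_const (2 * (v : ℝ))).congr_deriv ?_
    simp only [id_eq, Nat.cast_ofNat, Nat.add_one_sub_one, pow_one, mul_one]
    rw [← mul_neg, mul_div_mul_left _ _ two_ne_zero, neg_div]
  exact (hexponent.exp.const_mul _).congr_deriv (by ring)

theorem integral_sub_mul_gaussianReal {m : ℝ} {v : NNReal} {f f' : ℝ → ℝ}
    (hf : ∀ x, HasDerivAt f (f' x) x) (hfint : Integrable f (gaussianReal m v))
    (hf'int : Integrable f' (gaussianReal m v))
    (hmulint : Integrable (fun x => (x - m) * f x) (gaussianReal m v)) :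
    ∫ x, (x - m) * f x ∂gaussianReal m v = v * ∫ x, f' x ∂gaussianReal m v := by
  rcases eq_or_ne v 0 with rfl | hv
  · simp [gaussianReal_zero_var]
  have hv' : (v : ℝ) ≠ 0 := NNReal.coe_ne_zero.2 hv
  have integrable_pdf {g : ℝ → ℝ} (hg : Integrable g (gaussianReal m v)) :
      Integrable fun x => g x * gaussianPDFReal m v x := by
    rw [gaussianReal_of_var_ne_zero m hv, integrable_withDensity_iff_integrable_smul'
      (measurable_gaussianPDF m v) (ae_of_all _ fun x => gaussianPDF_lt_top)] at hg
    simpa only [toReal_gaussianPDF, smul_eq_mul, mul_comm] using hg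
  have hparts := integral_mul_deriv_eq_deriv_mul_of_integrable (fun x _ => hf x)
    (fun x _ => hasDerivAt_gaussianPDFReal m v x)
    (((integrable_pdf hmulint).const_mul (-(v : ℝ)⁻¹)).congr <| ae_of_all _ fun x => by
      simp only [Pi.mul_apply]
      ring)
    (integrable_pdf hf'int) (integrable_pdf hfint)
  simp only [integral_gaussianReal_eq_integral_smul hv, smul_eq_mul]
  calc ∫ x, gaussianPDFReal m v x * ((x - m) * f x)
      = ∫ x, -(v : ℝ) * (f x * (-((x - m) / v) * gaussianPDFReal m v x)) :=
        integral_congr_ae (ae_of_all _ fun x => by field_simp)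
    _ = v * ∫ x, gaussianPDFReal m v x * f' x := by
        rw [integral_const_mul, hparts, neg_mul_neg]
        simp only [mul_comm (f' _)]

lemma integrable_eval_gaussianReal (m : ℝ) (v : NNReal) (p : Polynomial ℝ) :
    Integrable (fun x => p.eval x) (gaussianReal m v) := by
  induction p using Polynomial.induction_on' with
  | add p q hp hq => exact (hp.add hq).congr (ae_of_all _ fun x => by simp)
  | monomial k a =>
    have hpow : Integrable (fun x => x ^ k) (gaussianReal m v) :=
      integrable_pow_of_mem_interior_integrableExpSet (X := fun x => x) (by simp) k
    simpa only [Polynomial.eval_monomial] using hpow.const_mul a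

lemma memLp_two_eval_gaussianReal (m : ℝ) (v : NNReal) (p : Polynomial ℝ) :
    MemLp (fun x => p.eval x) 2 (gaussianReal m v) := by
  refine (memLp_two_iff_integrable_sq p.continuous.aestronglyMeasurable).2 ?_
  exact (integrable_eval_gaussianReal m v (p ^ 2)).congr (ae_of_all _ fun x => by simp)

lemma integral_sub_mul_eval_gaussianReal (m : ℝ) (v : NNReal) (p : Polynomial ℝ) :
    ∫ x, (x - m) * p.eval x ∂gaussianReal m v =
      v * ∫ x, p.derivative.eval x ∂gaussianReal m v :=
  integral_sub_mul_gaussianReal (fun x => p.hasDerivAt x) (integrable_eval_gaussianReal m v p)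
    (integrable_eval_gaussianReal m v _) <|
    (integrable_eval_gaussianReal m v ((Polynomial.X - Polynomial.C m) * p)).congr
      (ae_of_all _ fun x => by simp)

/-- The Hermite polynomials orthogonal for the centred Gaussian law of variance `v`, in the
normalization with leading coefficient `1`. -/
def hermiteVar (v : ℝ) : ℕ → Polynomial ℝ
  | 0 => 1
  | k + 1 => Polynomial.X * hermiteVar v k - Polynomial.C v * (hermiteVar v k).derivative

lemma hermiteVar_succ (v : ℝ) (k : ℕ) : hermiteVar v (k + 1) =
    Polynomial.X * hermiteVar v k - Polynomial.C v * (hermiteVar v k).derivative := rfl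

lemma hermiteVar_one (v : ℝ) : hermiteVar v 1 = Polynomial.X := by
  simp [hermiteVar]

lemma derivative_hermiteVar_succ (v : ℝ) (k : ℕ) : (hermiteVar v (k + 1)).derivative =
    Polynomial.C ((k : ℝ) + 1) * hermiteVar v k := by
  induction k with
  | zero => simp [hermiteVar]
  | succ k ih =>
    rw [hermiteVar_succ v (k + 1)]
    simp only [Polynomial.derivative_sub, Polynomial.derivative_mul, Polynomial.derivative_X,
      Polynomial.derivative_C, ih]
    rw [hermiteVar_succ v k]
    simp only [Nat.cast_add, Nat.cast_one, Polynomial.C_add, Polynomial.C_1]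
    ring

lemma integral_hermiteVar_succ_mul_eval (m : ℝ) (v : NNReal) (k : ℕ) (q : Polynomial ℝ) :
    ∫ x, (hermiteVar v (k + 1)).eval x * q.eval x ∂gaussianReal m v =
      m * ∫ x, (hermiteVar v k).eval x * q.eval x ∂gaussianReal m v +
        v * ∫ x, (hermiteVar v k).eval x * q.derivative.eval x ∂gaussianReal m v := by
  have hint := integrable_eval_gaussianReal m v
  set p := hermiteVar v k
  have hstein := integral_sub_mul_eval_gaussianReal m v (p * q)
  have hsplit (x : ℝ) : (hermiteVar v (k + 1)).eval x * q.eval x =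
      m * (p * q).eval x + (x - m) * (p * q).eval x - v * (p.derivative * q).eval x := by
    simp only [hermiteVar_succ, Polynomial.eval_sub, Polynomial.eval_mul, Polynomial.eval_X,
      Polynomial.eval_C, p]
    ring
  have hmul : Integrable (fun x => (x - m) * (p * q).eval x) (gaussianReal m v) :=
    (hint ((Polynomial.X - Polynomial.C m) * (p * q))).congr (ae_of_all _ fun x => by simp)
  have hadd : Integrable (fun x => m * (p * q).eval x + (x - m) * (p * q).eval x)
      (gaussianReal m v) := ((hint _).const_mul m).add hmul
  simp_rw [hsplit]
  rw [integral_sub hadd ((hint _).const_mul _),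
    integral_add ((hint _).const_mul m) hmul, hstein, Polynomial.derivative_mul]
  simp_rw [Polynomial.eval_add]
  rw [integral_add (hint _) (hint _), integral_const_mul, integral_const_mul]
  simp only [Polynomial.eval_mul]
  ring

lemma integral_hermiteVar_gaussianReal (m : ℝ) (v : NNReal) (k : ℕ) :
    ∫ x, (hermiteVar v k).eval x ∂gaussianReal m v = m ^ k := by
  induction k with
  | zero => simp [hermiteVar]
  | succ k ih =>
    have h := integral_hermiteVar_succ_mul_eval m v k 1
    simp only [Polynomial.eval_one, mul_one, Polynomial.derivative_one, Polynomial.eval_zero,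
      mul_zero, integral_zero, add_zero] at h
    rw [h, ih, pow_succ']

lemma integral_hermiteVar_mul_hermiteVar_comp (v : NNReal) (u c w : ℝ) (k : ℕ) :
    ∫ x, (hermiteVar v k).eval x * (hermiteVar u k).eval (c * x + w) ∂gaussianReal 0 v =
      k.factorial * (c * v) ^ k := by
  induction k with
  | zero => simp [hermiteVar]
  | succ k ih =>
    set q := (hermiteVar u (k + 1)).comp (Polynomial.C c * Polynomial.X + Polynomial.C w) with hq
    have heval (x : ℝ) : (hermiteVar u (k + 1)).eval (c * x + w) = q.eval x := by simp [hq]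
    have hderiv (x : ℝ) :
        q.derivative.eval x = c * (k + 1) * (hermiteVar u k).eval (c * x + w) := by
      rw [hq, Polynomial.derivative_comp, derivative_hermiteVar_succ]
      simp [mul_assoc]
    simp_rw [heval]
    rw [integral_hermiteVar_succ_mul_eval, zero_mul, zero_add]
    simp_rw [hderiv, mul_left_comm _ (c * ((k : ℝ) + 1))]
    rw [integral_const_mul, ih, Nat.factorial_succ]
    push_cast
    ring

end Hermite

lemma measure_eq_of_mgf_id_eq {μ ν : Measure ℝ} [IsFiniteMeasure μ] [IsFiniteMeasure ν]
    (h : mgf id μ = mgf id ν) (hμ : ∀ t, Integrable (fun x => Real.exp (t * x)) μ) : μ = ν := by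
  have hzero : μ = 0 ↔ ν = 0 := by
    have hmass := congrFun h 0
    simp only [mgf_zero'] at hmass
    rw [← Measure.measure_univ_eq_zero, ← Measure.measure_univ_eq_zero,
      ← measureReal_eq_zero_iff, ← measureReal_eq_zero_iff, hmass]
  have hset : integrableExpSet id μ = Set.univ := Set.eq_univ_of_forall hμ
  exact Measure.ext_of_complexMGF_id_eq <| funext fun z =>
    eqOn_complexMGF_of_mgf' h hzero (by simp [hset])

section GaussianSpace

variable {Ω T : Type*} [MeasurableSpace Ω] {P : Measure Ω} {G : Submodule ℝ (Ω → ℝ)}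
  {Φ Ψ : Ω → ℝ}

/-- `G` is a (not necessarily closed) Gaussian space: a vector space of measurable centred Gaussian
random variables. They are automatically jointly Gaussian. -/
structure IsCentredGaussianSpace (P : Measure Ω) (G : Submodule ℝ (Ω → ℝ)) : Prop where
  measurable : ∀ Φ ∈ G, Measurable Φ
  hasGaussianLaw : ∀ Φ ∈ G, HasGaussianLaw Φ P
  integral_eq_zero : ∀ Φ ∈ G, ∫ ω, Φ ω ∂P = 0

lemma measurable_of_mem_span {B : T → Ω → ℝ} (hB : ∀ t, Measurable (B t))
    (hΦ : Φ ∈ Submodule.span ℝ (Set.range B)) : Measurable Φ := by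
  induction hΦ using Submodule.span_induction with
  | mem x hx => obtain ⟨t, rfl⟩ := hx; exact hB t
  | zero => exact measurable_zero
  | add x y _ _ hx hy => exact hx.add hy
  | smul a x _ hx => exact hx.const_smul a

lemma isCentredGaussianSpace_span {B : T → Ω → ℝ} (hmeas : ∀ t, Measurable (B t))
    (hB : IsGaussianProcess B P) (hmean : ∀ t, ∫ ω, B t ω ∂P = 0) :
    IsCentredGaussianSpace P (Submodule.span ℝ (Set.range B)) := by
  have hgauss : ∀ Φ ∈ Submodule.span ℝ (Set.range B), HasGaussianLaw Φ P := by
    intro Φ hΦ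
    obtain ⟨c, rfl⟩ := Finsupp.mem_span_range_iff_exists_finsupp.1 hΦ
    exact (hB.smul c).hasGaussianLaw_sum (I := c.support)
  refine ⟨fun _ hΦ => measurable_of_mem_span hmeas hΦ, hgauss, fun Φ hΦ => ?_⟩
  induction hΦ using Submodule.span_induction with
  | mem x hx => obtain ⟨t, rfl⟩ := hx; exact hmean t
  | zero => simp
  | add x y hx hy ihx ihy =>
    simp only [Pi.add_apply]
    rw [integral_add (hgauss x hx).integrable (hgauss y hy).integrable, ihx, ihy, add_zero]
  | smul a x _ ihx =>
    simp only [Pi.smul_apply, smul_eq_mul]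
    rw [integral_const_mul, ihx, mul_zero]

lemma coe_toNNReal_integral_sq (P : Measure Ω) (Φ : Ω → ℝ) :
    ((∫ ω, Φ ω ^ 2 ∂P).toNNReal : ℝ) = ∫ ω, Φ ω ^ 2 ∂P :=
  Real.coe_toNNReal _ (integral_nonneg fun _ => sq_nonneg _)

/-- The Hermite polynomial of degree `k` for the variance of a centred Gaussian variable `Φ`,
evaluated at `Φ`; it is the Wick power `Φ^{⋄ k}`. -/
def hermiteWickPow (P : Measure Ω) (Φ : Ω → ℝ) (k : ℕ) (ω : Ω) : ℝ :=
  (hermiteVar (∫ ω', Φ ω' ^ 2 ∂P) k).eval (Φ ω)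

lemma hermiteWickPow_zero (P : Measure Ω) (Φ : Ω → ℝ) : hermiteWickPow P Φ 0 = 1 := by
  funext ω
  simp [hermiteWickPow, hermiteVar]

lemma hermiteWickPow_one (P : Measure Ω) (Φ : Ω → ℝ) : hermiteWickPow P Φ 1 = Φ := by
  funext ω
  simp [hermiteWickPow, hermiteVar_one]

namespace IsCentredGaussianSpace

lemma isProbabilityMeasure (hG : IsCentredGaussianSpace P G) : IsProbabilityMeasure P :=
  (hG.hasGaussianLaw 0 G.zero_mem).isProbabilityMeasure

lemma map_eq_gaussianReal (hG : IsCentredGaussianSpace P G) (hΦ : Φ ∈ G) :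
    P.map Φ = gaussianReal 0 (∫ ω, Φ ω ^ 2 ∂P).toNNReal := by
  rw [(hG.hasGaussianLaw Φ hΦ).map_eq_gaussianReal, hG.integral_eq_zero Φ hΦ,
    variance_of_integral_eq_zero (hG.measurable Φ hΦ).aemeasurable (hG.integral_eq_zero Φ hΦ)]

lemma hasGaussianLaw_prodMk (hG : IsCentredGaussianSpace P G) (hΦ : Φ ∈ G) (hΨ : Ψ ∈ G) :
    HasGaussianLaw (fun ω => (Φ ω, Ψ ω)) P := by
  have hmeas := (hG.measurable Φ hΦ).prodMk (hG.measurable Ψ hΨ)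
  refine ⟨isGaussian_of_isGaussian_map fun L => ?_⟩
  have hL : L ∘ (fun ω => (Φ ω, Ψ ω)) = L (1, 0) • Φ + L (0, 1) • Ψ := by
    funext ω
    rw [Function.comp_apply, ← Prod.fst_add_snd (Φ ω, Ψ ω)]
    have h1 : (Φ ω, (0 : ℝ)) = Φ ω • (1, 0) := by simp
    have h2 : ((0 : ℝ), Ψ ω) = Ψ ω • (0, 1) := by simp
    rw [map_add, h1, h2, map_smul, map_smul]
    simp [mul_comm]
  rw [Measure.map_map L.continuous.measurable hmeas, hL]
  exact (hG.hasGaussianLaw _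
    (G.add_mem (G.smul_mem _ hΦ) (G.smul_mem _ hΨ))).isGaussian_map

lemma integrable_mul (hG : IsCentredGaussianSpace P G) (hΦ : Φ ∈ G) (hΨ : Ψ ∈ G) :
    Integrable (fun ω => Φ ω * Ψ ω) P :=
  (hG.hasGaussianLaw Φ hΦ).memLp_two.integrable_mul (hG.hasGaussianLaw Ψ hΨ).memLp_two

lemma integrable_sq (hG : IsCentredGaussianSpace P G) (hΦ : Φ ∈ G) :
    Integrable (fun ω => Φ ω ^ 2) P :=
  (hG.hasGaussianLaw Φ hΦ).memLp_two.integrable_sq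

lemma integral_smul_add_sq (hG : IsCentredGaussianSpace P G) (hΦ : Φ ∈ G) (hΨ : Ψ ∈ G) (a : ℝ) :
    ∫ ω, (a * Φ ω + Ψ ω) ^ 2 ∂P =
      a ^ 2 * ∫ ω, Φ ω ^ 2 ∂P + 2 * a * ∫ ω, Φ ω * Ψ ω ∂P + ∫ ω, Ψ ω ^ 2 ∂P := by
  have hΦsq := (hG.integrable_sq hΦ).const_mul (a ^ 2)
  have hΦΨ := (hG.integrable_mul hΦ hΨ).const_mul (2 * a)
  have hexpand (ω : Ω) : (a * Φ ω + Ψ ω) ^ 2 = a ^ 2 * Φ ω ^ 2 + 2 * a * (Φ ω * Ψ ω) + Ψ ω ^ 2 := by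
    ring
  simp_rw [hexpand]
  rw [integral_add (f := fun ω => a ^ 2 * Φ ω ^ 2 + 2 * a * (Φ ω * Ψ ω)) (hΦsq.add hΦΨ)
    (hG.integrable_sq hΨ), integral_add hΦsq hΦΨ, integral_const_mul, integral_const_mul]

lemma integral_exp (hG : IsCentredGaussianSpace P G) (hΦ : Φ ∈ G) :
    ∫ ω, Real.exp (Φ ω) ∂P = Real.exp ((∫ ω, Φ ω ^ 2 ∂P) / 2) := by
  have h := mgf_gaussianReal (hG.map_eq_gaussianReal hΦ) 1
  rw [coe_toNNReal_integral_sq] at h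
  simpa [mgf] using h

lemma integrable_exp (hG : IsCentredGaussianSpace P G) (hΦ : Φ ∈ G) :
    Integrable (fun ω => Real.exp (Φ ω)) P :=
  .of_integral_ne_zero <| (hG.integral_exp hΦ).trans_ne (Real.exp_pos _).ne'

lemma memLp_two_exp (hG : IsCentredGaussianSpace P G) (hΦ : Φ ∈ G) :
    MemLp (fun ω => Real.exp (Φ ω)) 2 P := by
  refine (memLp_two_iff_integrable_sq (hG.measurable Φ hΦ).exp.aestronglyMeasurable).2 ?_
  refine (hG.integrable_exp (G.smul_mem 2 hΦ)).congr (ae_of_all _ fun ω => ?_)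
  simp [← Real.exp_nat_mul]

lemma wickExp_eq (hG : IsCentredGaussianSpace P G) (hΨ : Ψ ∈ G) (ω : Ω) :
    wickExp P Ψ ω = Real.exp (Ψ ω) / ∫ ω', Real.exp (Ψ ω') ∂P := by
  simp only [wickExp, sq_abs]
  rw [hG.integral_exp hΨ, Real.exp_sub]

lemma memLp_two_wickExp (hG : IsCentredGaussianSpace P G) (hΨ : Ψ ∈ G) :
    MemLp (wickExp P Ψ) 2 P := by
  have heq : wickExp P Ψ = fun ω => (∫ ω', Real.exp (Ψ ω') ∂P)⁻¹ * Real.exp (Ψ ω) := by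
    funext ω
    rw [hG.wickExp_eq hΨ, div_eq_inv_mul]
  exact heq ▸ (hG.memLp_two_exp hΨ).const_mul _

lemma integral_mul_wickExp (hG : IsCentredGaussianSpace P G) (hΨ : Ψ ∈ G) (X : Ω → ℝ) :
    ∫ ω, X ω * wickExp P Ψ ω ∂P = ∫ ω, X ω ∂P.tilted Ψ := by
  rw [integral_tilted]
  simp only [hG.wickExp_eq hΨ, smul_eq_mul, mul_comm]

/-- The Cameron–Martin formula for one-dimensional marginals. -/
lemma map_tilted (hG : IsCentredGaussianSpace P G) (hΦ : Φ ∈ G) (hΨ : Ψ ∈ G) :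
    (P.tilted Ψ).map Φ =
      gaussianReal (∫ ω, Φ ω * Ψ ω ∂P) (∫ ω, Φ ω ^ 2 ∂P).toNNReal := by
  have hΦm := (hG.measurable Φ hΦ).aemeasurable (μ := P.tilted Ψ)
  have := hG.isProbabilityMeasure
  have := isProbabilityMeasure_tilted (hG.integrable_exp hΨ)
  have := Measure.isProbabilityMeasure_map hΦm
  refine (measure_eq_of_mgf_id_eq (funext fun a => ?_) integrable_exp_mul_gaussianReal).symm
  have hmem : a • Φ + Ψ ∈ G := G.add_mem (G.smul_mem a hΦ) hΨ
  have hexp : ∫ ω, Real.exp (a * Φ ω + Ψ ω) ∂P =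
      Real.exp ((∫ ω, (a * Φ ω + Ψ ω) ^ 2 ∂P) / 2) := hG.integral_exp hmem
  have hdensity (ω : Ω) : Real.exp (a * Φ ω) * wickExp P Ψ ω =
      Real.exp (a * Φ ω + Ψ ω) * (∫ ω', Real.exp (Ψ ω') ∂P)⁻¹ := by
    rw [hG.wickExp_eq hΨ, Real.exp_add]
    ring
  rw [mgf_id_gaussianReal, mgf_id_map hΦm, mgf, ← hG.integral_mul_wickExp hΨ]
  simp_rw [hdensity]
  rw [integral_mul_const, hexp, hG.integral_exp hΨ, hG.integral_smul_add_sq hΦ hΨ, ← Real.exp_neg,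
    ← Real.exp_add, coe_toNNReal_integral_sq]
  congr 1
  ring

lemma memLp_two_eval (hG : IsCentredGaussianSpace P G) (hΦ : Φ ∈ G) (p : Polynomial ℝ) :
    MemLp (fun ω => p.eval (Φ ω)) 2 P := by
  have h := memLp_two_eval_gaussianReal 0 (∫ ω, Φ ω ^ 2 ∂P).toNNReal p
  rw [← hG.map_eq_gaussianReal hΦ] at h
  exact (memLp_map_measure_iff p.continuous.aestronglyMeasurable
    (hG.measurable Φ hΦ).aemeasurable).1 h

theorem integral_hermiteWickPow_mul_wickExp (hG : IsCentredGaussianSpace P G) (hΦ : Φ ∈ G)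
    (hΨ : Ψ ∈ G) (k : ℕ) :
    ∫ ω, hermiteWickPow P Φ k ω * wickExp P Ψ ω ∂P = (∫ ω, Φ ω * Ψ ω ∂P) ^ k := by
  rw [hG.integral_mul_wickExp hΨ,
    ← integral_hermiteVar_gaussianReal _ (∫ ω, Φ ω ^ 2 ∂P).toNNReal, coe_toNNReal_integral_sq,
    ← hG.map_tilted hΦ hΨ, integral_map (hG.measurable Φ hΦ).aemeasurable
      (Polynomial.continuous _).aestronglyMeasurable]
  rfl

lemma exists_mul_integral_sq_eq (hG : IsCentredGaussianSpace P G) (Φ : Ω → ℝ) (hΨ : Ψ ∈ G) :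
    ∃ c, c * ∫ ω, Ψ ω ^ 2 ∂P = ∫ ω, Φ ω * Ψ ω ∂P := by
  by_cases hvar : ∫ ω, Ψ ω ^ 2 ∂P = 0
  · have hΨ0 : (fun ω => Ψ ω ^ 2) =ᵐ[P] 0 :=
      (integral_eq_zero_iff_of_nonneg (fun ω => sq_nonneg _) (hG.integrable_sq hΨ)).1 hvar
    refine ⟨0, ?_⟩
    rw [zero_mul, eq_comm]
    refine integral_eq_zero_of_ae ?_
    filter_upwards [hΨ0] with ω hω
    simp [pow_eq_zero_iff two_ne_zero |>.1 hω]
  · exact ⟨_, div_mul_cancel₀ _ hvar⟩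

lemma indepFun_sub_smul (hG : IsCentredGaussianSpace P G) (hΦ : Φ ∈ G) (hΨ : Ψ ∈ G) {c : ℝ}
    (hc : c * ∫ ω, Ψ ω ^ 2 ∂P = ∫ ω, Φ ω * Ψ ω ∂P) : IndepFun (Φ - c • Ψ) Ψ P := by
  have hmem : Φ - c • Ψ ∈ G := G.sub_mem hΦ (G.smul_mem c hΨ)
  have := hG.isProbabilityMeasure
  refine (hG.hasGaussianLaw_prodMk hmem hΨ).indepFun_of_covariance_eq_zero ?_
  rw [covariance_eq_sub (hG.hasGaussianLaw _ hmem).memLp_two (hG.hasGaussianLaw Ψ hΨ).memLp_two,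
    hG.integral_eq_zero Ψ hΨ, mul_zero, sub_zero]
  have hexpand (ω : Ω) : ((Φ - c • Ψ) * Ψ) ω = Φ ω * Ψ ω - c * Ψ ω ^ 2 := by
    simp only [Pi.mul_apply, Pi.sub_apply, Pi.smul_apply, smul_eq_mul]
    ring
  simp_rw [hexpand]
  rw [integral_sub (hG.integrable_mul hΦ hΨ) ((hG.integrable_sq hΨ).const_mul c),
    integral_const_mul, hc, sub_self]

theorem integral_hermiteWickPow_mul (hG : IsCentredGaussianSpace P G) (hΦ : Φ ∈ G)
    (hΨ : Ψ ∈ G) (k : ℕ) :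
    ∫ ω, hermiteWickPow P Φ k ω * hermiteWickPow P Ψ k ω ∂P =
      k.factorial * (∫ ω, Φ ω * Ψ ω ∂P) ^ k := by
  obtain ⟨c, hc⟩ := hG.exists_mul_integral_sq_eq Φ hΨ
  have hΨm := hG.measurable Ψ hΨ
  have hWm := (hG.measurable Φ hΦ).sub (hΨm.const_smul c)
  have := hG.isProbabilityMeasure
  have := Measure.isProbabilityMeasure_map (hWm.aemeasurable (μ := P))
  set p := hermiteVar (∫ ω, Φ ω ^ 2 ∂P) k
  set q := hermiteVar (∫ ω, Ψ ω ^ 2 ∂P) k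
  let F : ℝ × ℝ → ℝ := fun z => q.eval z.2 * p.eval (c * z.2 + z.1)
  have hF : Continuous F := by fun_prop
  have hF_pair (ω : Ω) : hermiteWickPow P Φ k ω * hermiteWickPow P Ψ k ω =
      F ((Φ - c • Ψ) ω, Ψ ω) := by
    simp [F, p, q, hermiteWickPow, mul_comm]
  have hlaw := (hG.indepFun_sub_smul hΦ hΨ hc).map_prod_eq_prod_map_map hWm.aemeasurable
    hΨm.aemeasurable
  have hFint : Integrable F ((P.map (Φ - c • Ψ)).prod (P.map Ψ)) := by
    rw [← hlaw, integrable_map_measure hF.aestronglyMeasurable (hWm.prodMk hΨm).aemeasurable]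
    exact ((hG.memLp_two_eval hΦ p).integrable_mul (hG.memLp_two_eval hΨ q)).congr
      (ae_of_all _ hF_pair)
  have hinner (w : ℝ) : ∫ x, F (w, x) ∂P.map Ψ = k.factorial * (∫ ω, Φ ω * Ψ ω ∂P) ^ k := by
    have h := integral_hermiteVar_mul_hermiteVar_comp (∫ ω, Ψ ω ^ 2 ∂P).toNNReal
      (∫ ω, Φ ω ^ 2 ∂P) c w k
    rwa [coe_toNNReal_integral_sq, hc, ← hG.map_eq_gaussianReal hΨ] at h
  calc ∫ ω, hermiteWickPow P Φ k ω * hermiteWickPow P Ψ k ω ∂P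
      = ∫ ω, F ((Φ - c • Ψ) ω, Ψ ω) ∂P := integral_congr_ae (ae_of_all _ hF_pair)
    _ = ∫ z, F z ∂(P.map (Φ - c • Ψ)).prod (P.map Ψ) := by
        rw [← hlaw, integral_map (hWm.prodMk hΨm).aemeasurable hF.aestronglyMeasurable]
    _ = k.factorial * (∫ ω, Φ ω * Ψ ω ∂P) ^ k := by
        rw [integral_prod F hFint]
        simp [hinner]

end IsCentredGaussianSpace

end GaussianSpace

section STransform

/-- The Cramér–Wold theorem. -/
lemma measure_eq_of_forall_map_dual_eq {E : Type*} [NormedAddCommGroup E] [NormedSpace ℝ E]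
    [CompleteSpace E] [SecondCountableTopology E] [MeasurableSpace E] [BorelSpace E]
    {μ ν : Measure E} [IsFiniteMeasure μ] [IsFiniteMeasure ν]
    (h : ∀ L : StrongDual ℝ E, μ.map L = ν.map L) : μ = ν :=
  Measure.ext_of_charFunDual <| funext fun L => by
    rw [charFunDual_eq_charFun_map_one, charFunDual_eq_charFun_map_one, h L]

variable {Ω T : Type*} {B : T → Ω → ℝ}

lemma dual_comp_restrict_mem_span (I : Finset T) (L : StrongDual ℝ (I → ℝ)) :
    (fun ω => L (I.restrict fun t => B t ω)) ∈ Submodule.span ℝ (Set.range B) := by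
  classical
  have hsum : (fun ω => L (I.restrict fun t => B t ω)) =
      ∑ t : I, L (fun j => if t = j then 1 else 0) • B t := by
    funext ω
    refine (L.toLinearMap.pi_apply_eq_sum_univ _).trans ?_
    simp [Finset.sum_apply, mul_comm]
  rw [hsum]
  exact Submodule.sum_mem _ fun t _ => Submodule.smul_mem _ _ (Submodule.subset_span ⟨t, rfl⟩)

lemma iSup_comap_eq_comap_pi (B : T → Ω → ℝ) :
    (⨆ t, MeasurableSpace.comap (B t) inferInstance) =
      MeasurableSpace.comap (fun ω t => B t ω) MeasurableSpace.pi := by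
  rw [MeasurableSpace.pi, MeasurableSpace.comap_iSup]
  simp_rw [MeasurableSpace.comap_comp]
  rfl

variable [MeasurableSpace Ω] {P : Measure Ω}

lemma map_process_eq_of_forall_span {μ ν : Measure Ω} [IsFiniteMeasure μ] [IsFiniteMeasure ν]
    (hB : ∀ t, Measurable (B t))
    (h : ∀ Ψ ∈ Submodule.span ℝ (Set.range B), μ.map Ψ = ν.map Ψ) :
    μ.map (fun ω t => B t ω) = ν.map fun ω t => B t ω := by
  have hBm : Measurable fun ω t => B t ω := measurable_pi_lambda _ hB
  have hfinite (I : Finset T) :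
      μ.map (fun ω => I.restrict fun t => B t ω) = ν.map fun ω => I.restrict fun t => B t ω := by
    have hIm := (Finset.measurable_restrict I).comp hBm
    refine measure_eq_of_forall_map_dual_eq fun L => ?_
    have hLm := L.continuous.measurable
    exact (Measure.map_map hLm hIm).trans
      ((h _ (dual_comp_restrict_mem_span I L)).trans (Measure.map_map hLm hIm).symm)
  have hlimit := isProjectiveLimit_map (P := μ) (X := B) hBm.aemeasurable
  simp_rw [hfinite] at hlimit
  exact hlimit.unique (isProjectiveLimit_map hBm.aemeasurable)

lemma measure_eq_of_integral_exp_eq {μ ν : Measure Ω} [IsFiniteMeasure μ] [IsFiniteMeasure ν]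
    (hB : ∀ t, Measurable (B t))
    (hint : ∀ Ψ ∈ Submodule.span ℝ (Set.range B), Integrable (fun ω => Real.exp (Ψ ω)) μ)
    (h : ∀ Ψ ∈ Submodule.span ℝ (Set.range B),
      ∫ ω, Real.exp (Ψ ω) ∂μ = ∫ ω, Real.exp (Ψ ω) ∂ν)
    {A : Set Ω} (hA : MeasurableSet[⨆ t, MeasurableSpace.comap (B t) inferInstance] A) :
    μ A = ν A := by
  have hBm : Measurable fun ω t => B t ω := measurable_pi_lambda _ hB
  have hmap : μ.map (fun ω t => B t ω) = ν.map fun ω t => B t ω := by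
    refine map_process_eq_of_forall_span hB fun Ψ hΨ => ?_
    have hΨm : Measurable Ψ := measurable_of_mem_span hB hΨ
    refine measure_eq_of_mgf_id_eq (funext fun a => ?_) fun a => ?_
    · rw [mgf_id_map hΨm.aemeasurable, mgf_id_map hΨm.aemeasurable]
      exact h _ (Submodule.smul_mem _ a hΨ)
    · rw [integrable_map_measure (by fun_prop) hΨm.aemeasurable]
      exact hint _ (Submodule.smul_mem _ a hΨ)
  rw [iSup_comap_eq_comap_pi] at hA
  obtain ⟨S, hS, rfl⟩ := hA
  rw [← Measure.map_apply hBm hS, ← Measure.map_apply hBm hS, hmap]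

lemma integrable_withDensity_ofReal {Z f : Ω → ℝ} (hZ : AEMeasurable Z P)
    (hf : AEStronglyMeasurable f P) (hZf : Integrable (fun ω => Z ω * f ω) P) :
    Integrable f (P.withDensity fun ω => ENNReal.ofReal (Z ω)) := by
  have hpos : AEMeasurable (fun ω => (Z ω).toNNReal) P := hZ.real_toNNReal
  refine (integrable_withDensity_iff_integrable_coe_smul₀ hpos).2 ?_
  refine hZf.mono (hpos.coe_nnreal_real.aestronglyMeasurable.smul hf) (ae_of_all _ fun ω => ?_)
  rw [smul_eq_mul, norm_mul, norm_mul]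
  gcongr
  rw [Real.coe_toNNReal', Real.norm_of_nonneg (le_max_right _ _), Real.norm_eq_abs]
  exact max_le (le_abs_self _) (abs_nonneg _)

lemma integral_withDensity_ofReal_sub {Z f : Ω → ℝ} (hZ : AEMeasurable Z P)
    (hf : AEStronglyMeasurable f P) (hZf : Integrable (fun ω => Z ω * f ω) P) :
    ∫ ω, f ω ∂P.withDensity (fun ω => ENNReal.ofReal (Z ω)) -
        ∫ ω, f ω ∂P.withDensity (fun ω => ENNReal.ofReal (-Z ω)) = ∫ ω, Z ω * f ω ∂P := by
  have hpos : AEMeasurable (fun ω => (Z ω).toNNReal) P := hZ.real_toNNReal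
  have hneg : AEMeasurable (fun ω => (-Z ω).toNNReal) P := hZ.neg.real_toNNReal
  have hposint := (integrable_withDensity_iff_integrable_coe_smul₀ hpos).1
    (integrable_withDensity_ofReal hZ hf hZf)
  have hnegint := (integrable_withDensity_iff_integrable_coe_smul₀ hneg).1
    (integrable_withDensity_ofReal hZ.neg hf (by simpa using hZf.neg))
  refine (congrArg₂ (· - ·) (integral_withDensity_eq_integral_smul₀ hpos f)
    (integral_withDensity_eq_integral_smul₀ hneg f)).trans ?_
  refine (integral_sub hposint hnegint).symm.trans (integral_congr_ae (ae_of_all _ fun ω => ?_))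
  simp only [smul_eq_mul, Real.coe_toNNReal', ← sub_mul, max_zero_sub_max_neg_zero_eq_self]

lemma withDensity_ofReal_real_sub {Z : Ω → ℝ} (hZ : Integrable Z P) {A : Set Ω}
    (hA : MeasurableSet A) :
    (P.withDensity fun ω => ENNReal.ofReal (Z ω)).real A -
      (P.withDensity fun ω => ENNReal.ofReal (-Z ω)).real A = ∫ ω in A, Z ω ∂P := by
  have hmul (ω : Ω) : Z ω * A.indicator 1 ω = A.indicator Z ω := by
    by_cases hω : ω ∈ A <;> simp [hω]
  rw [← integral_indicator_one hA, ← integral_indicator_one hA, integral_withDensity_ofReal_sub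
    hZ.aemeasurable (stronglyMeasurable_one.indicator hA).aestronglyMeasurable]
  · simp_rw [hmul]
    exact integral_indicator hA
  · simp_rw [hmul]
    exact hZ.indicator hA

theorem ae_eq_zero_of_forall_integral_mul_exp_eq_zero {Z : Ω → ℝ} [IsFiniteMeasure P]
    (hB : ∀ t, Measurable (B t))
    (hexp : ∀ Ψ ∈ Submodule.span ℝ (Set.range B), MemLp (fun ω => Real.exp (Ψ ω)) 2 P)
    (hZ : IsL2Functional P B Z)
    (h : ∀ Ψ ∈ Submodule.span ℝ (Set.range B), ∫ ω, Z ω * Real.exp (Ψ ω) ∂P = 0) :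
    Z =ᵐ[P] 0 := by
  have hZint : Integrable Z P := hZ.2.integrable one_le_two
  have hZexp (Ψ) (hΨ : Ψ ∈ Submodule.span ℝ (Set.range B)) :
      Integrable (fun ω => Z ω * Real.exp (Ψ ω)) P := hZ.2.integrable_mul (hexp Ψ hΨ)
  have := isFiniteMeasure_withDensity_ofReal hZint.2
  have := isFiniteMeasure_withDensity_ofReal hZint.neg.2
  refine ae_eq_of_forall_setIntegral_eq_of_sigmaFinite' (iSup_le fun t => (hB t).comap_le)
    (fun A _ _ => hZint.integrableOn) (fun A _ _ => integrableOn_zero) (fun A hA _ => ?_) hZ.1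
    aestronglyMeasurable_zero
  have heq := measure_eq_of_integral_exp_eq hB
    (fun Ψ hΨ => integrable_withDensity_ofReal hZint.aemeasurable (hexp Ψ hΨ).1 (hZexp Ψ hΨ))
    (fun Ψ hΨ => sub_eq_zero.1 ((integral_withDensity_ofReal_sub hZint.aemeasurable
      (hexp Ψ hΨ).1 (hZexp Ψ hΨ)).trans (h Ψ hΨ))) hA
  rw [← withDensity_ofReal_real_sub hZint (iSup_le (fun t => (hB t).comap_le) A hA),
    measureReal_def, measureReal_def, heq]
  simp

lemma IsL2Functional.congr {X Y : Ω → ℝ} (hX : IsL2Functional P B X) (h : X =ᵐ[P] Y) :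
    IsL2Functional P B Y :=
  ⟨hX.1.congr h, (memLp_congr_ae h).1 hX.2⟩

lemma IsL2Functional.sub {X Y : Ω → ℝ} (hX : IsL2Functional P B X) (hY : IsL2Functional P B Y) :
    IsL2Functional P B (X - Y) :=
  ⟨hX.1.sub hY.1, hX.2.sub hY.2⟩

end STransform

section WickPower

variable {Ω T : Type*} [MeasurableSpace Ω] {P : Measure Ω} {B : T → Ω → ℝ}

lemma integral_sub_sq_of_memLp_two {X Y : Ω → ℝ} (hX : MemLp X 2 P) (hY : MemLp Y 2 P) :
    ∫ ω, (X ω - Y ω) ^ 2 ∂P =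
      ∫ ω, X ω * X ω ∂P + ∫ ω, Y ω * Y ω ∂P - 2 * ∫ ω, X ω * Y ω ∂P := by
  calc ∫ ω, (X ω - Y ω) ^ 2 ∂P = ∫ ω, (X * X + Y * Y - (2 : ℝ) • (X * Y)) ω ∂P := by
        congr with ω
        simp only [Pi.sub_apply, Pi.add_apply, Pi.mul_apply, Pi.smul_apply, smul_eq_mul]
        ring
    _ = _ := by
        rw [integral_sub' ((hX.integrable_mul hX).add (hY.integrable_mul hY))
          ((hX.integrable_mul hY).smul 2), integral_add' (hX.integrable_mul hX)
          (hY.integrable_mul hY)]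
        simp only [Pi.smul_apply, smul_eq_mul, Pi.mul_apply, integral_const_mul]

lemma isL2Functional_hermiteWickPow
    (hG : IsCentredGaussianSpace P (Submodule.span ℝ (Set.range B))) (t : T) (k : ℕ) :
    IsL2Functional P B (hermiteWickPow P (B t) k) := by
  have hBt : Measurable[⨆ t, MeasurableSpace.comap (B t) inferInstance] (B t) :=
    (comap_measurable (B t)).mono
      (le_iSup (fun t => MeasurableSpace.comap (B t) inferInstance) t) le_rfl
  exact ⟨((Polynomial.continuous _).measurable.comp hBt).stronglyMeasurable.aestronglyMeasurable,
    hG.memLp_two_eval (Submodule.subset_span ⟨t, rfl⟩) _⟩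

lemma ae_eq_of_isWickProduct (hG : IsCentredGaussianSpace P (Submodule.span ℝ (Set.range B)))
    {X Y Z Z' : Ω → ℝ} (hZ : IsWickProduct P B X Y Z) (hZ' : IsWickProduct P B X Y Z') :
    Z =ᵐ[P] Z' := by
  have := hG.isProbabilityMeasure
  rw [← sub_ae_eq_zero]
  refine ae_eq_zero_of_forall_integral_mul_exp_eq_zero
    (fun t => hG.measurable _ (Submodule.subset_span ⟨t, rfl⟩)) (fun Ψ hΨ => hG.memLp_two_exp hΨ)
    (hZ.2.2.1.sub hZ'.2.2.1) fun Ψ hΨ => ?_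
  have hexp (ω : Ω) : (Z - Z') ω * Real.exp (Ψ ω) =
      (Z ω * wickExp P Ψ ω - Z' ω * wickExp P Ψ ω) * ∫ ω, Real.exp (Ψ ω) ∂P := by
    have hpos : (∫ ω, Real.exp (Ψ ω) ∂P) ≠ 0 := hG.integral_exp hΨ ▸ (Real.exp_pos _).ne'
    rw [hG.wickExp_eq hΨ, Pi.sub_apply]
    field_simp
  simp_rw [hexp]
  have hsub := integral_sub (hZ.2.2.1.2.integrable_mul (hG.memLp_two_wickExp hΨ))
    (hZ'.2.2.1.2.integrable_mul (hG.memLp_two_wickExp hΨ))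
  simp only [Pi.mul_apply] at hsub
  rw [integral_mul_const, hsub, hZ.2.2.2 Ψ hΨ, hZ'.2.2.2 Ψ hΨ, sub_self, zero_mul]

lemma IsWickProduct.congr_left {X X' Y Z : Ω → ℝ} (h : IsWickProduct P B X Y Z)
    (hX : X =ᵐ[P] X') : IsWickProduct P B X' Y Z := by
  refine ⟨h.1.congr hX, h.2.1, h.2.2.1, fun Ψ hΨ => ?_⟩
  rw [h.2.2.2 Ψ hΨ]
  congr 1
  exact integral_congr_ae (hX.mul (ae_eq_refl (wickExp P Ψ)))

lemma isWickProduct_hermiteWickPow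
    (hG : IsCentredGaussianSpace P (Submodule.span ℝ (Set.range B))) (t : T) (k : ℕ) :
    IsWickProduct P B (hermiteWickPow P (B t) k) (B t) (hermiteWickPow P (B t) (k + 1)) := by
  have ht : B t ∈ Submodule.span ℝ (Set.range B) := Submodule.subset_span ⟨t, rfl⟩
  have hone := isL2Functional_hermiteWickPow hG t 1
  rw [hermiteWickPow_one] at hone
  refine ⟨isL2Functional_hermiteWickPow hG t k, hone, isL2Functional_hermiteWickPow hG t (k + 1),
    fun Ψ hΨ => ?_⟩
  have hS := hG.integral_hermiteWickPow_mul_wickExp ht hΨ 1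
  rw [hermiteWickPow_one, pow_one] at hS
  rw [hG.integral_hermiteWickPow_mul_wickExp ht hΨ, hG.integral_hermiteWickPow_mul_wickExp ht hΨ,
    hS, pow_succ]

theorem wickPow_ae_eq_hermiteWickPow
    (hG : IsCentredGaussianSpace P (Submodule.span ℝ (Set.range B))) (t : T) :
    ∀ k, wickPow P B (B t) k =ᵐ[P] hermiteWickPow P (B t) k
  | 0 => by rw [hermiteWickPow_zero]; rfl
  | 1 => by rw [hermiteWickPow_one]; rfl
  | k + 2 => by
    have hW := (isWickProduct_hermiteWickPow hG t (k + 1)).congr_left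
      (wickPow_ae_eq_hermiteWickPow hG t (k + 1)).symm
    have hex : ∃ Z, IsWickProduct P B (wickPow P B (B t) (k + 1)) (B t) Z := ⟨_, hW⟩
    rw [wickPow, wick, dif_pos hex]
    exact ae_eq_of_isWickProduct hG hex.choose_spec hW

theorem integral_wickPow_mul_wickPow
    (hG : IsCentredGaussianSpace P (Submodule.span ℝ (Set.range B))) (s t : T) (k : ℕ) :
    ∫ ω, wickPow P B (B t) k ω * wickPow P B (B s) k ω ∂P =
      k.factorial * (∫ ω, B t ω * B s ω ∂P) ^ k :=
  (integral_congr_ae ((wickPow_ae_eq_hermiteWickPow hG t k).mul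
    (wickPow_ae_eq_hermiteWickPow hG s k))).trans <|
    hG.integral_hermiteWickPow_mul (Submodule.subset_span ⟨t, rfl⟩)
      (Submodule.subset_span ⟨s, rfl⟩) k

lemma memLp_two_wickPow (hG : IsCentredGaussianSpace P (Submodule.span ℝ (Set.range B)))
    (t : T) (k : ℕ) : MemLp (wickPow P B (B t) k) 2 P :=
  ((isL2Functional_hermiteWickPow hG t k).congr (wickPow_ae_eq_hermiteWickPow hG t k).symm).2

theorem IsFBM.integral_wickPow_sub_sq {H : ℝ} {B : unitInterval → Ω → ℝ} (hB : IsFBM P H B)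
    (N : ℕ) (s t : unitInterval) :
    ∫ ω, (wickPow P B (B t) N ω - wickPow P B (B s) N ω) ^ 2 ∂P =
      N.factorial * (fbmCov H t t ^ N + fbmCov H s s ^ N - 2 * fbmCov H t s ^ N) := by
  have hG := isCentredGaussianSpace_span hB.measurable hB.gaussian hB.mean_zero
  have hcov (r r' : unitInterval) :
      ∫ ω, wickPow P B (B r) N ω * wickPow P B (B r') N ω ∂P =
        N.factorial * fbmCov H r r' ^ N := by
    rw [integral_wickPow_mul_wickPow hG, hB.covariance, fbmCov]
  rw [integral_sub_sq_of_memLp_two (memLp_two_wickPow hG t N) (memLp_two_wickPow hG s N), hcov,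
    hcov, hcov]
  ring

end WickPower

end WickFBM

end

theorem proposition4p3_general {Ω : Type*} [MeasurableSpace Ω] (P : Measure Ω)
    (H : ℝ) (hH : 1 / 2 < H) (hH' : H < 1)
    (ξ : (n : ℕ) → Fin n → Ω → ℝ) (hξ : ∀ n, WickFBM.IsStandardIndep P (ξ n)) :
    (∀ (n N : ℕ) (s t : unitInterval), 1 ≤ n → s ≤ t →
      (∫ ω, (WickFBM.disturbedWalk H (ξ n) t ω) ^ 2 ∂P) ^ N
          + (∫ ω, (WickFBM.disturbedWalk H (ξ n) s ω) ^ 2 ∂P) ^ N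
          - 2 * (∫ ω, WickFBM.disturbedWalk H (ξ n) t ω *
              WickFBM.disturbedWalk H (ξ n) s ω ∂P) ^ N
          - 1 / (N.factorial : ℝ) *
            ∫ ω, (WickFBM.discreteWickPow P (ξ n) (WickFBM.disturbedWalk H (ξ n) t) N ω
              - WickFBM.discreteWickPow P (ξ n) (WickFBM.disturbedWalk H (ξ n) s) N ω) ^ 2 ∂P
        ∈ Set.Icc 0 (2 * WickFBM.cH H ^ 2 * (N : ℝ) ^ 2 * (t : ℝ) ^ (2 * H * ((N : ℝ) - 1)) *
            (n : ℝ) ^ (-(2 - 2 * H)))) ∧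
    (∀ {Ω' : Type*} [MeasurableSpace Ω'] (P' : Measure Ω')
      (B : unitInterval → Ω' → ℝ), WickFBM.IsFBM P' H B →
      ∀ (N : ℕ) (s t : unitInterval),
        Tendsto (fun n : ℕ =>
            ∫ ω, (WickFBM.discreteWickPow P (ξ n) (WickFBM.disturbedWalk H (ξ n) t) N ω
              - WickFBM.discreteWickPow P (ξ n) (WickFBM.disturbedWalk H (ξ n) s) N ω) ^ 2 ∂P)
          atTop
          (𝓝 (∫ ω,
            (WickFBM.wickPow P' B (B t) N ω - WickFBM.wickPow P' B (B s) N ω) ^ 2 ∂P'))) := by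
  refine ⟨fun n N s t _ hst => (hξ n).wickPow_defect_mem_Icc hH hH' N hst,
    fun P' B hB N s t => ?_⟩
  rw [hB.integral_wickPow_sub_sq]
  exact WickFBM.tendsto_integral_discreteWickPow_sub_sq hξ hH hH' N s t

theorem proposition4p3 {Ω : Type*} [MeasurableSpace Ω] (P : Measure Ω) [IsProbabilityMeasure P]
    (H : ℝ) (hH : 1 / 2 < H) (hH' : H < 1)
    (ξ : (n : ℕ) → Fin n → Ω → ℝ) (hξ : WickFBM.IsBernoulliArray P ξ) :
    (∀ (n N : ℕ) (s t : unitInterval), 1 ≤ n → s ≤ t → N ≤ ⌊(n : ℝ) * (s : ℝ)⌋₊ →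
      (∫ ω, (WickFBM.disturbedWalk H (ξ n) t ω) ^ 2 ∂P) ^ N
          + (∫ ω, (WickFBM.disturbedWalk H (ξ n) s ω) ^ 2 ∂P) ^ N
          - 2 * (∫ ω, WickFBM.disturbedWalk H (ξ n) t ω *
              WickFBM.disturbedWalk H (ξ n) s ω ∂P) ^ N
          - 1 / (N.factorial : ℝ) *
            ∫ ω, (WickFBM.discreteWickPow P (ξ n) (WickFBM.disturbedWalk H (ξ n) t) N ω
              - WickFBM.discreteWickPow P (ξ n) (WickFBM.disturbedWalk H (ξ n) s) N ω) ^ 2 ∂P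
        ∈ Set.Icc 0 (2 * WickFBM.cH H ^ 2 * (N : ℝ) ^ 2 * (t : ℝ) ^ (2 * H * ((N : ℝ) - 1)) *
            (n : ℝ) ^ (-(2 - 2 * H)))) ∧
    (∀ {Ω' : Type*} [MeasurableSpace Ω'] (P' : Measure Ω') [IsProbabilityMeasure P']
      (B : unitInterval → Ω' → ℝ), WickFBM.IsFBM P' H B →
      ∀ (N : ℕ) (s t : unitInterval), s ≤ t →
        Tendsto (fun n : ℕ =>
            ∫ ω, (WickFBM.discreteWickPow P (ξ n) (WickFBM.disturbedWalk H (ξ n) t) N ω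
              - WickFBM.discreteWickPow P (ξ n) (WickFBM.disturbedWalk H (ξ n) s) N ω) ^ 2 ∂P)
          atTop
          (𝓝 (∫ ω, (WickFBM.wickPow P' B (B t) N ω - WickFBM.wickPow P' B (B s) N ω) ^ 2 ∂P'))) := by
  have h := proposition4p3_general P H hH hH' ξ fun n => hξ.isStandardIndep n
  exact ⟨fun n N s t hn hst _ => h.1 n N s t hn hst, fun P' _ B hB N s t _ => h.2 P' B hB N s t⟩
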